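/- Let $\mathbb N=\{1,2,\dots\}$. For $\varepsilon,\sigma>0$, a positive sequence $b=(b_j)_{j\in\mathbb N}$ and $\theta\in l^2(\mathbb N)$, let $\mathbb P_{\theta,b}$ (depending also on $\varepsilon,\sigma$) be the joint law of the observations $$Y_j=b_j\theta_j+\varepsilon\,\xi_j,\qquad X_j=b_j+\sigma\,\eta_j,\qquad j\in\mathbb N,$$ where all $\xi_j,\eta_j$ are independent standard Gaussian variables. Let $a=(a_j)$ be a non-decreasing sequence of positive reals with $a_j\to+\infty$, and put $\mathcal E_a=\{\theta\in l^2(\mathbb N):\sum_j a_j^2\theta_j^2\le 1\}$ and $\Theta_a(r)=\{\theta\in\mathcal E_a:\|\theta\|\ge r\}$. For constants $0<C_0\le 1\le C_1<\infty$ with $C_0<C_1$, let $\mathcal B(b)=\{\nu: C_0b_j\le\nu_j\le C_1b_j \text{ for all } j\}$, and let $\mathcal V$ be any set of sequences with $b\in\mathcal V\subseteq\mathcal B(b)$ (for instance $\mathcal V=\{b\}$ or $\mathcal V=\mathcal B(b)$). A test $\Psi$ assigns to each benchmark $\theta_0\in\mathcal E_a$, $\theta_0\ne0$, a measurable $\{0,1\}$-valued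 function $\Psi_{\theta_0}$ of $(Y,X)$; the value $1$ means that $\theta=\theta_0$ is rejected. Let $\alpha\in(0,1)$ and $\beta\in(0,1-\alpha)$. The test has level $\alpha$ if $\mathbb P_{\theta_0,\nu}(\Psi_{\theta_0}=1)\le\alpha$ for all such $\theta_0$ and all $\nu\in\mathcal B(b)$ (the singular values are unknown). Its separation radius $r_{\varepsilon,\sigma}(\Psi)$ is the infimum of the $r>0$ such that $$\sup\{\mathbb P_{\theta,\nu}(\Psi_{\theta_0}=0):\ 0\ne\theta_0\in\mathcal E_a,\ \theta-\theta_0\in\Theta_a(r),\ \nu\in\mathcal V\}\le\beta,$$ and the minimax separation radius $\tilde r_{\varepsilon,\sigma}$ is the infimum of $r_{\varepsilon,\sigma}(\Psi)$ over all tests $\Psi$ of level $\alpha$. Write $c_j\sim d_j$ if there are $0<\kappa_0\le\kappa_1<\infty$ with $\kappa_0\le c_j/d_j\le\kappa_1$ for all $j\in\mathbb N$. Let $s,t>0$. In each of the following four cases there exist $\varepsilon_0,\sigma_0\in(0,1)$ and a constant $\kappa>0$ (not depending on $\varepsilon,\sigma$) such that, for all $0<\varepsilon\le\varepsilon_0$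 and $0<\sigma\le\sigma_0$, $\tilde r_{\varepsilon,\sigma}^2\ge\kappa\,\rho_{\varepsilon,\sigma}$, where (i) if $b_j\sim j^{-t}$ and $a_j\sim j^s$: $\ \rho_{\varepsilon,\sigma}=\varepsilon^{\frac{4s}{2s+2t+1/2}}\vee\sigma^{2(\frac st\wedge1)}$; (ii) if $b_j\sim j^{-t}$ and $a_j\sim e^{js}$: $\ \rho_{\varepsilon,\sigma}=\varepsilon^2[\ln(1/\varepsilon)]^{2t+\frac12}\vee\sigma^2$; (iii) if $b_j\sim e^{-jt}$ and $a_j\sim j^s$: $\ \rho_{\varepsilon,\sigma}=[\ln(1/\varepsilon)]^{-2s}\vee[\ln(1/\sigma)]^{-2s}$; (iv) if $b_j\sim e^{-jt}$ and $a_j\sim e^{js}$: $\ \rho_{\varepsilon,\sigma}=\varepsilon^{\frac{2s}{s+t}}\vee\sigma^{2(\frac st\wedge1)}$. -/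

import Mathlib

open MeasureTheory ProbabilityTheory Filter

noncomputable section

namespace NoisyGSM

/-- The space `l²(ℕ)` of square-summable real sequences, with `ℕ = {1, 2, …}`. -/
abbrev Ell2 : Type := lp (fun _ : ℕ+ => ℝ) 2

/-- The observation space: pairs `(Y, X)` of real sequences. -/
abbrev Obs : Type := (ℕ+ → ℝ) × (ℕ+ → ℝ)

/-- The joint law `P_{θ,b}` of the observations `Y_j = b_j θ_j + ε ξ_j`, `X_j = b_j + σ η_j`,
where all the `ξ_j`, `η_j` are independent standard Gaussian variables. -/
def law (ε σ : ℝ) (θ : Ell2) (b : ℕ+ → ℝ) : Measure Obs :=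
  (Measure.infinitePi fun j : ℕ+ => gaussianReal (b j * θ j) (Real.toNNReal (ε ^ 2))).prod
    (Measure.infinitePi fun j : ℕ+ => gaussianReal (b j) (Real.toNNReal (σ ^ 2)))

/-- The ellipsoid `E_a = {θ ∈ l² : ∑ a_j² θ_j² ≤ 1}`. -/
def ellipsoid (a : ℕ+ → ℝ) : Set Ell2 :=
  {θ | Summable (fun j => a j ^ 2 * θ j ^ 2) ∧ ∑' j, a j ^ 2 * θ j ^ 2 ≤ 1}

/-- `Θ_a(r)`: the ellipsoid with the open `l²`-ball of radius `r` removed. -/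
def separatedSet (a : ℕ+ → ℝ) (r : ℝ) : Set Ell2 :=
  {θ | θ ∈ ellipsoid a ∧ r ≤ ‖θ‖}

/-- The sequences of singular values comparable to `b` with constants `C₀`, `C₁`. -/
def singularClass (b : ℕ+ → ℝ) (C₀ C₁ : ℝ) : Set (ℕ+ → ℝ) :=
  {ν | ∀ j, C₀ * b j ≤ ν j ∧ ν j ≤ C₁ * b j}

/-- The admissible benchmark signals: the nonzero elements of the ellipsoid. -/
def benchmarks (a : ℕ+ → ℝ) : Set Ell2 :=
  {θ₀ | θ₀ ∈ ellipsoid a ∧ θ₀ ≠ 0}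

/-- A non-randomized goodness-of-fit testing procedure: for each (known) benchmark `θ₀`, a
measurable `{0,1}`-valued function of the observation. The value `1` rejects `θ = θ₀`. The
procedure does not have access to the singular values. -/
structure Test where
  toFun : Ell2 → Obs → Fin 2
  measurable_toFun : ∀ θ₀, Measurable (toFun θ₀)

/-- `Ψ` is an `α`-level test: for every benchmark, the probability of rejecting it when it is the
true signal is at most `α`, whatever the unknown singular values in the class `𝓑`. -/
def IsLevelTest (a : ℕ+ → ℝ) (𝓑 : Set (ℕ+ → ℝ)) (α ε σ : ℝ) (Ψ : Test) : Prop :=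
  ∀ θ₀ ∈ benchmarks a, ∀ ν ∈ 𝓑, law ε σ θ₀ ν {z | Ψ.toFun θ₀ z = 1} ≤ ENNReal.ofReal α

/-- The maximal second kind error probability over benchmarks `θ₀`, signals `θ` with
`θ - θ₀ ∈ Θ_a(r)`, and singular values in `𝓥`. It is `0` if there are no such signals. -/
def secondKindError (a : ℕ+ → ℝ) (𝓥 : Set (ℕ+ → ℝ)) (ε σ r : ℝ) (Ψ : Test) : ENNReal :=
  ⨆ θ₀ ∈ benchmarks a, ⨆ θ ∈ {θ : Ell2 | θ - θ₀ ∈ separatedSet a r}, ⨆ ν ∈ 𝓥,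
    law ε σ θ ν {z | Ψ.toFun θ₀ z = 0}

/-- The separation radius of a test. -/
def separationRadius (a : ℕ+ → ℝ) (𝓥 : Set (ℕ+ → ℝ)) (β ε σ : ℝ) (Ψ : Test) : ℝ :=
  sInf {r : ℝ | 0 < r ∧ secondKindError a 𝓥 ε σ r Ψ ≤ ENNReal.ofReal β}

/-- The minimax separation radius: the infimum of the separation radii of the tests that have
level `α` for all singular values in `𝓑`, the second kind error being taken over `𝓥`. -/
def minimaxRadius (a : ℕ+ → ℝ) (𝓑 𝓥 : Set (ℕ+ → ℝ)) (α β ε σ : ℝ) : ℝ :=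
  sInf (separationRadius a 𝓥 β ε σ '' {Ψ | IsLevelTest a 𝓑 α ε σ Ψ})

/-- `c_j ∼ d_j`: the ratio lies between two positive constants, for all `j`. -/
def Comparable (c d : ℕ+ → ℝ) : Prop :=
  ∃ κ₀ κ₁ : ℝ, 0 < κ₀ ∧ κ₀ ≤ κ₁ ∧ ∀ j, κ₀ ≤ c j / d j ∧ c j / d j ≤ κ₁

/-- `f ≳ g` for small noise levels: there are `ε₀, σ₀ ∈ (0,1)` and `κ > 0` such that
`f ε σ ≥ κ g ε σ` for all `0 < ε ≤ ε₀` and `0 < σ ≤ σ₀`. -/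
def GtrsimSmallNoise (f g : ℝ → ℝ → ℝ) : Prop :=
  ∃ ε₀ ∈ Set.Ioo (0 : ℝ) 1, ∃ σ₀ ∈ Set.Ioo (0 : ℝ) 1, ∃ κ > 0,
    ∀ ε σ : ℝ, 0 < ε → ε ≤ ε₀ → 0 < σ → σ ≤ σ₀ → κ * g ε σ ≤ f ε σ

end NoisyGSM

end

/-!
If under some `P = P_{θ₀,ν₀}` the laws `P_{θ,b}` of certain signals `θ` with `‖θ - θ₀‖ = r` have an
average `Q` whose likelihood ratio has second moment at most `1 + l²`, then every event satisfies
`P(A) ≤ Q(A) + l`, so that no test distinguishes `P` from all these `P_{θ,b}` when `α + β + l < 1`,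
and the minimax radius is at least `r`. Two choices give the two terms of the rates.

* Noise in `Y`: let `θ = θ₀ ± g` with independent random signs and `ν₀ = b`. The second moment is a
  product of `cosh (b_j² g_j² / ε²)`, hence bounded as long as `∑ b_j⁴ g_j⁴` is of order `ε⁴`. With
  `g_j` proportional to `b_j⁻²` on a block of coordinates this allows
  `‖g‖² = ε² √(∑ b_j⁻⁴)`, subject to the ellipsoid constraint.
* Noise in `X`: choose `θ` and `ν₀` with `b θ = ν₀ θ₀` and `ν₀` different from `b` in one coordinate
  `j` only. Then `Y` carries no information, and detecting the change from `X` requires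
  `|b_j - ν₀_j|` to exceed the order `σ`, while `θ - θ₀` may be as large as
  `a_j⁻¹ min(σ / b_j, 1)`.
-/

noncomputable section

namespace NoisyGSM

open scoped NNReal ENNReal

section SecondMoment

variable {Ω : Type*} [MeasurableSpace Ω] {P : Measure Ω} [IsProbabilityMeasure P]

lemma one_tsub_sq_add_two_mul_le (x : ℝ≥0∞) : (1 - x) ^ 2 + 2 * x ≤ 1 + x ^ 2 := by
  rcases le_total 1 x with hx | hx
  · obtain ⟨y, rfl⟩ := exists_add_of_le hx
    calc (1 - (1 + y)) ^ 2 + 2 * (1 + y) = 2 + 2 * y := by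
          rw [tsub_eq_zero_of_le hx]; ring
      _ ≤ 2 + 2 * y + y ^ 2 := le_self_add
      _ = 1 + (1 + y) ^ 2 := by ring
  · have hx' : 1 - x + x = 1 := tsub_add_cancel_of_le hx
    refine le_of_eq ?_
    calc (1 - x) ^ 2 + 2 * x = (1 - x) ^ 2 + 2 * (1 - x + x) * x := by rw [hx', mul_one]
      _ = (1 - x + x) ^ 2 + x ^ 2 := by ring
      _ = 1 + x ^ 2 := by rw [hx', one_pow]

lemma sq_lintegral_le_lintegral_sq {f : Ω → ℝ≥0∞} (hf : AEMeasurable f P) :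
    (∫⁻ x, f x ∂P) ^ 2 ≤ ∫⁻ x, f x ^ 2 ∂P := by
  have h : ∫⁻ x, f x ∂P ≤ (∫⁻ x, f x ^ 2 ∂P) ^ (2⁻¹ : ℝ) := by
    simpa [eLpNorm'] using
      eLpNorm'_le_eLpNorm'_of_exponent_le one_pos one_le_two P hf.aestronglyMeasurable
  simpa using (ENNReal.le_rpow_inv_iff two_pos).1 h

lemma lintegral_one_tsub_le {G : Ω → ℝ≥0∞} (hG : Measurable G) (hG₁ : ∫⁻ x, G x ∂P = 1) {l : ℝ≥0}
    (hG₂ : ∫⁻ x, G x ^ 2 ∂P ≤ 1 + l ^ 2) : ∫⁻ x, (1 - G x) ∂P ≤ l := by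
  have h : ∫⁻ x, (1 - G x) ^ 2 ∂P + 2 ≤ l ^ 2 + 2 :=
    calc ∫⁻ x, (1 - G x) ^ 2 ∂P + 2 = ∫⁻ x, ((1 - G x) ^ 2 + 2 * G x) ∂P := by
          rw [lintegral_add_left (by fun_prop), lintegral_const_mul _ hG, hG₁, mul_one]
      _ ≤ ∫⁻ x, (1 + G x ^ 2) ∂P := lintegral_mono fun x => one_tsub_sq_add_two_mul_le (G x)
      _ = 1 + ∫⁻ x, G x ^ 2 ∂P := by
          rw [lintegral_add_left measurable_const, lintegral_one, measure_univ]
      _ ≤ 1 + (1 + l ^ 2) := by gcongr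
      _ = l ^ 2 + 2 := by ring
  have h' : ∫⁻ x, (1 - G x) ^ 2 ∂P ≤ l ^ 2 :=
    (ENNReal.add_le_add_iff_right ENNReal.ofNat_ne_top).1 h
  exact (ENNReal.pow_le_pow_left_iff two_ne_zero).1
    ((sq_lintegral_le_lintegral_sq (by fun_prop)).trans h')

variable {l : ℝ≥0} {φ : Ω → ℝ≥0∞}

lemma lintegral_le_lintegral_withDensity_add {G : Ω → ℝ≥0∞} (hG : Measurable G)
    (hG₁ : ∫⁻ x, G x ∂P = 1) (hG₂ : ∫⁻ x, G x ^ 2 ∂P ≤ 1 + l ^ 2) (hφ : Measurable φ)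
    (hφ₁ : ∀ x, φ x ≤ 1) : ∫⁻ x, φ x ∂P ≤ ∫⁻ x, φ x ∂P.withDensity G + l := by
  have hpt : ∀ x, φ x ≤ (G * φ) x + (1 - G x) := fun x =>
    calc φ x ≤ (G x + (1 - G x)) * φ x := le_mul_of_one_le_left' le_add_tsub
      _ = G x * φ x + (1 - G x) * φ x := add_mul ..
      _ ≤ G x * φ x + (1 - G x) := by gcongr; exact mul_le_of_le_one_right' (hφ₁ x)
  calc ∫⁻ x, φ x ∂P ≤ ∫⁻ x, (G * φ) x ∂P + ∫⁻ x, (1 - G x) ∂P := by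
        rw [← lintegral_add_left (hG.mul hφ)]
        exact lintegral_mono hpt
    _ ≤ ∫⁻ x, φ x ∂P.withDensity G + l := by
        rw [lintegral_withDensity_eq_lintegral_mul _ hG hφ]
        gcongr
        exact lintegral_one_tsub_le hG hG₁ hG₂

lemma exists_lintegral_le_lintegral_withDensity_add {κ : Type*} {T : Finset κ} (hT : T.Nonempty)
    {F : κ → Ω → ℝ≥0∞} (hF : ∀ i, Measurable (F i)) {G : Ω → ℝ≥0∞} (hG : Measurable G)
    (hFG : ∀ x, ∑ i ∈ T, F i x = T.card * G x) (hG₁ : ∫⁻ x, G x ∂P = 1)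
    (hG₂ : ∫⁻ x, G x ^ 2 ∂P ≤ 1 + l ^ 2) (hφ : Measurable φ) (hφ₁ : ∀ x, φ x ≤ 1) :
    ∃ i ∈ T, ∫⁻ x, φ x ∂P ≤ ∫⁻ x, φ x ∂P.withDensity (F i) + l := by
  obtain ⟨i, hi, hmax⟩ := T.exists_max_image (fun i => ∫⁻ x, φ x ∂P.withDensity (F i)) hT
  refine ⟨i, hi, (lintegral_le_lintegral_withDensity_add hG hG₁ hG₂ hφ hφ₁).trans
    (add_le_add_left ?_ _)⟩
  have hmean : (T.card : ℝ≥0∞) * ∫⁻ x, φ x ∂P.withDensity G ≤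
      T.card * ∫⁻ x, φ x ∂P.withDensity (F i) :=
    calc (T.card : ℝ≥0∞) * ∫⁻ x, φ x ∂P.withDensity G
        = ∫⁻ x, ∑ k ∈ T, F k x * φ x ∂P := by
          rw [lintegral_withDensity_eq_lintegral_mul _ hG hφ, ← lintegral_const_mul _ (hG.mul hφ)]
          simp only [Pi.mul_apply, ← mul_assoc, ← hFG, Finset.sum_mul]
      _ = ∑ k ∈ T, ∫⁻ x, F k x * φ x ∂P := lintegral_finsetSum _ fun k _ => (hF k).mul hφ
      _ = ∑ k ∈ T, ∫⁻ x, φ x ∂P.withDensity (F k) :=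
          Finset.sum_congr rfl fun k _ =>
            (lintegral_withDensity_eq_lintegral_mul _ (hF k) hφ).symm
      _ ≤ ∑ _k ∈ T, ∫⁻ x, φ x ∂P.withDensity (F i) := Finset.sum_le_sum hmax
      _ = T.card * ∫⁻ x, φ x ∂P.withDensity (F i) := by rw [Finset.sum_const, nsmul_eq_mul]
  rwa [ENNReal.mul_le_mul_iff_right (by simpa using hT.ne_empty) (ENNReal.natCast_ne_top _)]
    at hmean

end SecondMoment

section InfinitePi

variable {ι : Type*} {X : ι → Type*} [∀ i, MeasurableSpace (X i)]

lemma lintegral_prod_infinitePi (μ : ∀ i, Measure (X i)) [∀ i, IsProbabilityMeasure (μ i)]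
    (s : Finset ι) {f : ∀ i, X i → ℝ≥0∞} (hf : ∀ i, Measurable (f i)) :
    ∫⁻ x, ∏ i ∈ s, f i (x i) ∂Measure.infinitePi μ = ∏ i ∈ s, ∫⁻ x, f i x ∂μ i := by
  rw [lintegral_prod_eq_prod_lintegral_of_indepFun s (fun i (x : ∀ i, X i) => f i (x i))
    (iIndepFun_infinitePi hf) (fun i => (hf i).comp (measurable_pi_apply i))]
  exact Finset.prod_congr rfl fun i _ =>
    (measurePreserving_eval_infinitePi μ i).lintegral_comp (hf i)

theorem infinitePi_withDensity (μ ν : ∀ i, Measure (X i)) [∀ i, IsProbabilityMeasure (μ i)]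
    [∀ i, IsProbabilityMeasure (ν i)] {s : Finset ι} {f : ∀ i, X i → ℝ≥0∞}
    (hf : ∀ i, Measurable (f i)) (hf₁ : ∀ i ∉ s, f i = 1)
    (hν : ∀ i, ν i = (μ i).withDensity (f i)) :
    Measure.infinitePi ν = (Measure.infinitePi μ).withDensity fun x => ∏ i ∈ s, f i (x i) := by
  classical
  refine (Measure.eq_infinitePi ν fun u A hA => ?_).symm
  set B : ∀ i, Set (X i) := fun i => if i ∈ u then A i else Set.univ
  have hB : ∀ i, MeasurableSet (B i) := fun i => by
    by_cases hi : i ∈ u <;> simp [B, hi, hA i]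
  have hind : (Set.pi u A).indicator (fun x => ∏ i ∈ s, f i (x i)) =
      fun x => ∏ i ∈ u ∪ s, (B i).indicator (f i) (x i) := by
    ext x
    have hout : ∏ i ∈ s, f i (x i) = ∏ i ∈ u ∪ s, f i (x i) :=
      Finset.prod_subset Finset.subset_union_right fun i _ hi => by rw [hf₁ i hi, Pi.one_apply]
    have hmem : x ∈ Set.pi u A ↔ ∀ i ∈ u ∪ s, x i ∈ B i := by
      simp only [Set.mem_pi, B, SetLike.mem_coe]
      grind
    simp only [Set.indicator, Finset.prod_ite_zero, hout, hmem]
  calc (Measure.infinitePi μ).withDensity (fun x => ∏ i ∈ s, f i (x i)) (Set.pi u A)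
      = ∫⁻ x, ∏ i ∈ u ∪ s, (B i).indicator (f i) (x i) ∂Measure.infinitePi μ := by
        have hpi : MeasurableSet (Set.pi (u : Set ι) A) :=
          .pi u.countable_toSet fun i _ => hA i
        rw [withDensity_apply _ hpi, ← lintegral_indicator hpi, hind]
    _ = ∏ i ∈ u ∪ s, ν i (B i) := by
        rw [lintegral_prod_infinitePi _ _ fun i => (hf i).indicator (hB i)]
        refine Finset.prod_congr rfl fun i _ => ?_
        rw [lintegral_indicator (hB i), hν i, withDensity_apply _ (hB i)]
    _ = ∏ i ∈ u, ν i (B i) :=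
        (Finset.prod_subset Finset.subset_union_left fun i _ hi => by simp [B, hi]).symm
    _ = ∏ i ∈ u, ν i (A i) := Finset.prod_congr rfl fun i hi => by simp [B, hi]

end InfinitePi

section Gaussian

/-- The density of `N(m + h, v)` with respect to `N(m, v)`. -/
def shiftDensity (m : ℝ) (v : ℝ≥0) (h x : ℝ) : ℝ≥0∞ :=
  ENNReal.ofReal (Real.exp (h * (x - m) / v - h ^ 2 / (2 * v)))

@[fun_prop]
lemma measurable_shiftDensity (m : ℝ) (v : ℝ≥0) (h : ℝ) : Measurable (shiftDensity m v h) := by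
  unfold shiftDensity
  fun_prop

lemma shiftDensity_zero (m : ℝ) (v : ℝ≥0) : shiftDensity m v 0 = 1 := by
  ext x
  simp [shiftDensity]

variable (m : ℝ) {v : ℝ≥0} (hv : v ≠ 0) (h k : ℝ)
include hv

lemma gaussianReal_add_eq_withDensity :
    gaussianReal (m + h) v = (gaussianReal m v).withDensity (shiftDensity m v h) := by
  have hv' : (v : ℝ) ≠ 0 := NNReal.coe_ne_zero.2 hv
  rw [gaussianReal_of_var_ne_zero _ hv, gaussianReal_of_var_ne_zero _ hv,
    ← withDensity_mul _ (measurable_gaussianPDF _ _) (measurable_shiftDensity _ _ _)]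
  congr 1
  ext x
  simp only [gaussianPDF, shiftDensity, Pi.mul_apply, gaussianPDFReal]
  rw [← ENNReal.ofReal_mul (by positivity), mul_assoc (√(2 * Real.pi * v))⁻¹, ← Real.exp_add]
  congr 3
  field_simp
  ring

lemma lintegral_shiftDensity : ∫⁻ x, shiftDensity m v h x ∂gaussianReal m v = 1 := by
  rw [← setLIntegral_univ, ← withDensity_apply _ .univ, ← gaussianReal_add_eq_withDensity m hv,
    measure_univ]

lemma shiftDensity_mul_shiftDensity (x : ℝ) :
    shiftDensity m v h x * shiftDensity m v k x =
      ENNReal.ofReal (Real.exp (h * k / v)) * shiftDensity m v (h + k) x := by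
  have hv' : (v : ℝ) ≠ 0 := NNReal.coe_ne_zero.2 hv
  simp only [shiftDensity, ← ENNReal.ofReal_mul (Real.exp_nonneg _), ← Real.exp_add]
  congr 2
  field_simp
  ring

lemma lintegral_shiftDensity_mul_shiftDensity :
    ∫⁻ x, shiftDensity m v h x * shiftDensity m v k x ∂gaussianReal m v =
      ENNReal.ofReal (Real.exp (h * k / v)) := by
  simp_rw [shiftDensity_mul_shiftDensity m hv]
  rw [lintegral_const_mul _ (measurable_shiftDensity _ _ _), lintegral_shiftDensity _ hv, mul_one]

omit hv in
/-- The density of the mixture of `N(m + h, v)` and `N(m - h, v)` with equal weights, with respect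
to `N(m, v)`. -/
def mixDensity (m : ℝ) (v : ℝ≥0) (h x : ℝ) : ℝ≥0∞ :=
  2⁻¹ * (shiftDensity m v h x + shiftDensity m v (-h) x)

omit hv in
@[fun_prop]
lemma measurable_mixDensity (v : ℝ≥0) : Measurable (mixDensity m v h) := by
  unfold mixDensity
  fun_prop

lemma lintegral_mixDensity : ∫⁻ x, mixDensity m v h x ∂gaussianReal m v = 1 := by
  simp only [mixDensity]
  rw [lintegral_const_mul _ (by fun_prop), lintegral_add_left (by fun_prop),
    lintegral_shiftDensity _ hv, lintegral_shiftDensity _ hv, one_add_one_eq_two,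
    ENNReal.inv_mul_cancel two_ne_zero ENNReal.ofNat_ne_top]

lemma lintegral_mixDensity_sq :
    ∫⁻ x, mixDensity m v h x ^ 2 ∂gaussianReal m v = ENNReal.ofReal (Real.cosh (h ^ 2 / v)) := by
  have hexpand : ∀ x, mixDensity m v h x ^ 2 = 2⁻¹ ^ 2 *
      (shiftDensity m v h x * shiftDensity m v h x +
        2 * (shiftDensity m v h x * shiftDensity m v (-h) x) +
        shiftDensity m v (-h) x * shiftDensity m v (-h) x) := fun x => by
    unfold mixDensity
    ring
  have hhalf : (2⁻¹ : ℝ≥0∞) ^ 2 = ENNReal.ofReal (2⁻¹ ^ 2) := by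
    rw [ENNReal.ofReal_pow (by norm_num), ENNReal.ofReal_inv_of_pos two_pos, ENNReal.ofReal_ofNat]
  simp_rw [hexpand]
  rw [lintegral_const_mul _ (by fun_prop), lintegral_add_left (by fun_prop),
    lintegral_add_left (by fun_prop), lintegral_const_mul _ (by fun_prop)]
  simp_rw [lintegral_shiftDensity_mul_shiftDensity m hv]
  rw [hhalf, ← ENNReal.ofReal_ofNat 2, ← ENNReal.ofReal_mul zero_le_two,
    ← ENNReal.ofReal_add (by positivity) (by positivity),
    ← ENNReal.ofReal_add (by positivity) (by positivity), ← ENNReal.ofReal_mul (by positivity),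
    Real.cosh_eq]
  ring_nf

end Gaussian

section GaussianSequence

variable {ι : Type*}

/-- The law of a family of independent Gaussian variables with means `m j` and common variance
`v`. -/
def gaussianSeq (m : ι → ℝ) (v : ℝ≥0) : Measure (ι → ℝ) :=
  Measure.infinitePi fun j => gaussianReal (m j) v

instance (m : ι → ℝ) (v : ℝ≥0) : IsProbabilityMeasure (gaussianSeq m v) := by
  unfold gaussianSeq
  infer_instance

lemma prod_ofReal_exp_le_one_add_sq {s : Finset ι} {x : ι → ℝ} {l : ℝ≥0}
    (hx : ∑ j ∈ s, x j ≤ Real.log (1 + l ^ 2)) :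
    ∏ j ∈ s, ENNReal.ofReal (Real.exp (x j)) ≤ 1 + l ^ 2 := by
  rw [← ENNReal.ofReal_prod_of_nonneg fun j _ => Real.exp_nonneg _, ← Real.exp_sum]
  refine ENNReal.ofReal_le_of_le_toReal ?_
  rw [← Real.le_log_iff_exp_le (ENNReal.toReal_pos (by simp) (by finiteness))]
  simpa [ENNReal.toReal_add] using hx

variable {m h : ι → ℝ} {v : ℝ≥0} {s : Finset ι} {l : ℝ≥0} {φ : (ι → ℝ) → ℝ≥0∞}

lemma gaussianSeq_add_eq_withDensity (hv : v ≠ 0) (hs : ∀ j ∉ s, h j = 0) :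
    gaussianSeq (m + h) v =
      (gaussianSeq m v).withDensity fun y => ∏ j ∈ s, shiftDensity (m j) v (h j) (y j) :=
  infinitePi_withDensity _ _ (fun j => measurable_shiftDensity (m j) v (h j))
    (fun j hj => by rw [hs j hj, shiftDensity_zero])
    fun j => gaussianReal_add_eq_withDensity (m j) hv (h j)

theorem lintegral_gaussianSeq_le_add (hv : v ≠ 0) (hs : ∀ j ∉ s, h j = 0)
    (hh : ∑ j ∈ s, h j ^ 2 / v ≤ Real.log (1 + l ^ 2)) (hφ : Measurable φ) (hφ₁ : ∀ y, φ y ≤ 1) :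
    ∫⁻ y, φ y ∂gaussianSeq m v ≤ ∫⁻ y, φ y ∂gaussianSeq (m + h) v + l := by
  rw [gaussianSeq_add_eq_withDensity hv hs]
  refine lintegral_le_lintegral_withDensity_add (by fun_prop) ?_ ?_ hφ hφ₁
  · rw [gaussianSeq, lintegral_prod_infinitePi _ _ fun j => measurable_shiftDensity (m j) v (h j)]
    exact Finset.prod_eq_one fun j _ => lintegral_shiftDensity _ hv _
  · simp_rw [← Finset.prod_pow]
    rw [gaussianSeq, lintegral_prod_infinitePi _ _ fun j =>
      (measurable_shiftDensity (m j) v (h j)).pow_const 2]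
    simp_rw [sq (shiftDensity _ _ _ _), lintegral_shiftDensity_mul_shiftDensity _ hv, ← sq]
    exact prod_ofReal_exp_le_one_add_sq hh

lemma sum_powerset_prod_shiftDensity [DecidableEq ι] (m h : ι → ℝ) (v : ℝ≥0) (s : Finset ι)
    (y : ι → ℝ) :
    ∑ t ∈ s.powerset, ∏ j ∈ s, shiftDensity (m j) v ((if j ∈ t then 1 else -1) * h j) (y j) =
      s.powerset.card * ∏ j ∈ s, mixDensity (m j) v (h j) (y j) := by
  have hcancel : ((2 ^ s.card : ℕ) : ℝ≥0∞) * 2⁻¹ ^ s.card = 1 := by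
    rw [Nat.cast_pow, Nat.cast_ofNat, ← mul_pow,
      ENNReal.mul_inv_cancel two_ne_zero ENNReal.ofNat_ne_top, one_pow]
  simp only [mixDensity]
  rw [Finset.prod_mul_distrib, Finset.prod_add, Finset.prod_const, Finset.card_powerset,
    ← mul_assoc, hcancel, one_mul]
  refine Finset.sum_congr rfl fun t ht => ?_
  rw [← Finset.prod_sdiff (Finset.mem_powerset.1 ht), mul_comm]
  congr 1
  · exact Finset.prod_congr rfl fun j hj => by rw [if_pos hj, one_mul]
  · exact Finset.prod_congr rfl fun j hj => by
      rw [if_neg (Finset.mem_sdiff.1 hj).2, neg_one_mul]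

lemma lintegral_prod_mixDensity_sq_le (hv : v ≠ 0)
    (hh : ∑ j ∈ s, h j ^ 4 / (2 * v ^ 2) ≤ Real.log (1 + l ^ 2)) :
    ∫⁻ y, (∏ j ∈ s, mixDensity (m j) v (h j) (y j)) ^ 2 ∂gaussianSeq m v ≤ 1 + l ^ 2 := by
  simp_rw [← Finset.prod_pow]
  rw [gaussianSeq, lintegral_prod_infinitePi _ _ fun j =>
    (measurable_mixDensity (m j) (h j) v).pow_const 2]
  simp_rw [lintegral_mixDensity_sq _ hv]
  refine le_trans (Finset.prod_le_prod' fun j _ => ?_) (prod_ofReal_exp_le_one_add_sq hh)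
  refine ENNReal.ofReal_le_ofReal ((Real.cosh_le_exp_half_sq _).trans_eq ?_)
  ring_nf

theorem exists_lintegral_gaussianSeq_le_add (hv : v ≠ 0) (hs : ∀ j ∉ s, h j = 0)
    (hh : ∑ j ∈ s, h j ^ 4 / (2 * v ^ 2) ≤ Real.log (1 + l ^ 2)) (hφ : Measurable φ)
    (hφ₁ : ∀ y, φ y ≤ 1) :
    ∃ η : ι → ℝ, (∀ j, η j ^ 2 = 1) ∧
      ∫⁻ y, φ y ∂gaussianSeq m v ≤ ∫⁻ y, φ y ∂gaussianSeq (m + η * h) v + l := by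
  classical
  obtain ⟨t, -, ht⟩ := exists_lintegral_le_lintegral_withDensity_add (P := gaussianSeq m v)
    s.powerset_nonempty
    (fun t => Finset.measurable_prod _ fun j _ => (measurable_shiftDensity _ _ _).comp
      (measurable_pi_apply j))
    (by fun_prop) (sum_powerset_prod_shiftDensity m h v s)
    (by
      rw [gaussianSeq, lintegral_prod_infinitePi _ _ fun j => measurable_mixDensity (m j) (h j) v]
      exact Finset.prod_eq_one fun j _ => lintegral_mixDensity _ hv _)
    (lintegral_prod_mixDensity_sq_le hv hh) hφ hφ₁
  refine ⟨fun j => if j ∈ t then 1 else -1, fun j => by by_cases hj : j ∈ t <;> simp [hj], ?_⟩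
  rw [gaussianSeq_add_eq_withDensity hv fun j hj => by rw [Pi.mul_apply, hs j hj, mul_zero]]
  exact ht

end GaussianSequence

section Radius

variable {a : ℕ+ → ℝ} {𝓑 𝓥 : Set (ℕ+ → ℝ)} {α β ε σ : ℝ}

lemma law_eq_prod_gaussianSeq (ε σ : ℝ) (θ : Ell2) (b : ℕ+ → ℝ) :
    law ε σ θ b = (gaussianSeq (b * ⇑θ) (ε ^ 2).toNNReal).prod (gaussianSeq b (σ ^ 2).toNNReal) :=
  rfl

instance (ε σ : ℝ) (θ : Ell2) (b : ℕ+ → ℝ) : IsProbabilityMeasure (law ε σ θ b) := by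
  unfold law
  infer_instance

lemma norm_sq_eq_tsum_sq (θ : Ell2) : ‖θ‖ ^ 2 = ∑' j, θ j ^ 2 := by
  simpa using lp.norm_rpow_eq_tsum (p := 2) (by norm_num) θ

lemma summable_sq (θ : Ell2) : Summable fun j => θ j ^ 2 := by
  simpa using (lp.memℓp θ).summable (p := 2) (by norm_num)

lemma mul_norm_le_one_of_mem_ellipsoid {a₀ : ℝ} (ha₀ : 0 ≤ a₀) (ha : ∀ j, a₀ ≤ a j) {θ : Ell2}
    (hθ : θ ∈ ellipsoid a) : a₀ * ‖θ‖ ≤ 1 := by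
  refine (sq_le_one_iff₀ (by positivity)).1 ?_
  calc (a₀ * ‖θ‖) ^ 2 = ∑' j, a₀ ^ 2 * θ j ^ 2 := by
        rw [mul_pow, norm_sq_eq_tsum_sq, tsum_mul_left]
    _ ≤ ∑' j, a j ^ 2 * θ j ^ 2 := by
        refine ((summable_sq θ).mul_left _).tsum_le_tsum (fun j => ?_) hθ.1
        gcongr
        exact ha j
    _ ≤ 1 := hθ.2

lemma exists_secondKindError_le {a₀ : ℝ} (ha₀ : 0 < a₀) (ha : ∀ j, a₀ ≤ a j) (Ψ : Test) :
    ∃ r, 0 < r ∧ secondKindError a 𝓥 ε σ r Ψ ≤ ENNReal.ofReal β := by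
  refine ⟨2 / a₀, by positivity, ?_⟩
  simp only [secondKindError, iSup_le_iff]
  rintro θ₀ - θ ⟨hθ, hr⟩
  have hnorm := mul_norm_le_one_of_mem_ellipsoid ha₀.le ha hθ
  rw [div_le_iff₀' ha₀] at hr
  linarith

lemma le_minimaxRadius {a₀ : ℝ} (ha₀ : 0 < a₀) (ha : ∀ j, a₀ ≤ a j) {r : ℝ}
    (h : ∀ Ψ, IsLevelTest a 𝓑 α ε σ Ψ → ∀ r' ≤ r,
      ENNReal.ofReal β < secondKindError a 𝓥 ε σ r' Ψ) :
    r ≤ minimaxRadius a 𝓑 𝓥 α β ε σ := by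
  have hlevel : IsLevelTest a 𝓑 α ε σ ⟨fun _ _ => 0, fun _ => measurable_const⟩ :=
    fun θ₀ _ ν _ => by simp
  refine le_csInf ⟨_, Set.mem_image_of_mem _ hlevel⟩ ?_
  rintro _ ⟨Ψ, hΨ, rfl⟩
  refine le_csInf (exists_secondKindError_le ha₀ ha Ψ) ?_
  rintro r' ⟨-, hr'⟩
  by_contra! hlt
  exact (h Ψ hΨ r' hlt.le).not_ge hr'

lemma measurableSet_accept (Ψ : Test) (θ₀ : Ell2) : MeasurableSet {z | Ψ.toFun θ₀ z = 0} :=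
  Ψ.measurable_toFun θ₀ (measurableSet_singleton 0)

lemma one_le_law_accept_add {Ψ : Test} (hΨ : IsLevelTest a 𝓑 α ε σ Ψ) {θ₀ : Ell2}
    (hθ₀ : θ₀ ∈ benchmarks a) {ν : ℕ+ → ℝ} (hν : ν ∈ 𝓑) :
    1 ≤ law ε σ θ₀ ν {z | Ψ.toFun θ₀ z = 0} + ENNReal.ofReal α := by
  have hcompl : {z | Ψ.toFun θ₀ z = 0}ᶜ = {z | Ψ.toFun θ₀ z = 1} := by
    ext z
    simp only [Set.mem_compl_iff, Set.mem_ofPred_eq]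
    lia
  rw [← prob_add_prob_compl (μ := law ε σ θ₀ ν) (measurableSet_accept Ψ θ₀)]
  gcongr
  exact hcompl ▸ hΨ θ₀ hθ₀ ν hν

theorem le_minimaxRadius_of_law_le_add {a₀ : ℝ} (ha₀ : 0 < a₀) (ha : ∀ j, a₀ ≤ a j) (hα : 0 ≤ α)
    (hβ : 0 ≤ β) {l : ℝ≥0} (hl : α + β + l < 1) {θ₀ : Ell2} (hθ₀ : θ₀ ∈ benchmarks a)
    {ν₀ : ℕ+ → ℝ} (hν₀ : ν₀ ∈ 𝓑) {r : ℝ}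
    (h : ∀ A, MeasurableSet A → ∃ θ, θ - θ₀ ∈ separatedSet a r ∧ ∃ ν ∈ 𝓥,
      law ε σ θ₀ ν₀ A ≤ law ε σ θ ν A + l) :
    r ≤ minimaxRadius a 𝓑 𝓥 α β ε σ := by
  refine le_minimaxRadius ha₀ ha fun Ψ hΨ r' hr' => ?_
  by_contra! hle
  obtain ⟨θ, hθ, ν, hν, hlaw⟩ :=
    h {z | Ψ.toFun θ₀ z = 0} (measurableSet_accept Ψ θ₀)
  have hsecond : law ε σ θ ν {z | Ψ.toFun θ₀ z = 0} ≤ secondKindError a 𝓥 ε σ r' Ψ :=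
    le_iSup₂_of_le θ₀ hθ₀ (le_iSup₂_of_le θ ⟨hθ.1, hr'.trans hθ.2⟩ (le_iSup₂_of_le ν hν le_rfl))
  have hsum : 1 ≤ ENNReal.ofReal (α + β + l) :=
    calc 1 ≤ law ε σ θ₀ ν₀ {z | Ψ.toFun θ₀ z = 0} + ENNReal.ofReal α :=
          one_le_law_accept_add hΨ hθ₀ hν₀
      _ ≤ ENNReal.ofReal β + l + ENNReal.ofReal α := by
          gcongr
          exact hlaw.trans (by gcongr; exact hsecond.trans hle)
      _ = ENNReal.ofReal (α + β + l) := by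
          rw [ENNReal.ofReal_add (add_nonneg hα hβ) l.coe_nonneg, ENNReal.ofReal_add hα hβ,
            ENNReal.ofReal_coe_nnreal]
          ring
  exact (ENNReal.one_le_ofReal.1 hsum).not_gt hl

end Radius

section FiniteSignal

variable {a : ℕ+ → ℝ} {s : Finset ℕ+} {g : ℕ+ → ℝ}

/-- The signal with coordinates `g j` for `j ∈ s` and `0` elsewhere. -/
def finiteSignal (s : Finset ℕ+) (g : ℕ+ → ℝ) : Ell2 := ∑ j ∈ s, lp.single 2 j (g j)

lemma finiteSignal_apply (s : Finset ℕ+) (g : ℕ+ → ℝ) (j : ℕ+) :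
    finiteSignal s g j = if j ∈ s then g j else 0 := by
  rw [finiteSignal, lp.coeFn_sum, Finset.sum_apply]
  simp [Pi.single_apply]

lemma norm_sq_finiteSignal (s : Finset ℕ+) (g : ℕ+ → ℝ) :
    ‖finiteSignal s g‖ ^ 2 = ∑ j ∈ s, g j ^ 2 := by
  rw [norm_sq_eq_tsum_sq, tsum_eq_sum (s := s) fun j hj => by simp [finiteSignal_apply, hj]]
  exact Finset.sum_congr rfl fun j hj => by rw [finiteSignal_apply, if_pos hj]

lemma finiteSignal_mem_ellipsoid_iff :
    finiteSignal s g ∈ ellipsoid a ↔ ∑ j ∈ s, a j ^ 2 * g j ^ 2 ≤ 1 := by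
  have hzero : ∀ j ∉ s, a j ^ 2 * finiteSignal s g j ^ 2 = 0 := fun j hj => by
    simp [finiteSignal_apply, hj]
  have hsum : ∑ j ∈ s, a j ^ 2 * finiteSignal s g j ^ 2 = ∑ j ∈ s, a j ^ 2 * g j ^ 2 :=
    Finset.sum_congr rfl fun j hj => by rw [finiteSignal_apply, if_pos hj]
  rw [ellipsoid, Set.mem_ofPred_eq, and_iff_right (summable_of_ne_finset_zero hzero),
    tsum_eq_sum hzero, hsum]

lemma finiteSignal_singleton_mem_benchmarks {j : ℕ+} (ha : 0 < a j) :
    finiteSignal {j} (fun j => (a j)⁻¹) ∈ benchmarks a := by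
  refine ⟨finiteSignal_mem_ellipsoid_iff.2 ?_, fun h => ?_⟩
  · rw [Finset.sum_singleton, ← mul_pow, mul_inv_cancel₀ ha.ne', one_pow]
  · have hj := finiteSignal_apply {j} (fun j => (a j)⁻¹) j
    rw [h, if_pos (Finset.mem_singleton_self j), lp.coeFn_zero, Pi.zero_apply] at hj
    exact inv_ne_zero ha.ne' hj.symm

end FiniteSignal

section LowerBounds

variable {a b : ℕ+ → ℝ} {𝓑 𝓥 : Set (ℕ+ → ℝ)} {α β ε σ a₀ : ℝ} {l : ℝ≥0} {s : Finset ℕ+}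

theorem sum_sq_le_minimaxRadius_sq (ha₀ : 0 < a₀) (ha : ∀ j, a₀ ≤ a j) (hα : 0 ≤ α) (hβ : 0 ≤ β)
    (hl : α + β + l < 1) (hb𝓑 : b ∈ 𝓑) (hb𝓥 : b ∈ 𝓥) (hε : 0 < ε) {g : ℕ+ → ℝ}
    (hga : ∑ j ∈ s, a j ^ 2 * g j ^ 2 ≤ 1)
    (hgb : ∑ j ∈ s, (b j * g j) ^ 4 ≤ 2 * Real.log (1 + l ^ 2) * ε ^ 4) :
    ∑ j ∈ s, g j ^ 2 ≤ minimaxRadius a 𝓑 𝓥 α β ε σ ^ 2 := by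
  rw [← norm_sq_finiteSignal]
  refine pow_le_pow_left₀ (norm_nonneg _) ?_ 2
  set h : ℕ+ → ℝ := b * ⇑(finiteSignal s g)
  have hv : (ε ^ 2).toNNReal ≠ 0 := (Real.toNNReal_pos.2 (by positivity)).ne'
  have hsum : ∑ j ∈ s, h j ^ 4 / (2 * ((ε ^ 2).toNNReal : ℝ) ^ 2) ≤ Real.log (1 + l ^ 2) := by
    have hh : ∑ j ∈ s, h j ^ 4 = ∑ j ∈ s, (b j * g j) ^ 4 := Finset.sum_congr rfl fun j hj => by
      simp only [h, Pi.mul_apply, finiteSignal_apply, if_pos hj]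
    rw [← Finset.sum_div, hh, Real.coe_toNNReal _ (by positivity), div_le_iff₀ (by positivity)]
    linarith
  refine le_minimaxRadius_of_law_le_add ha₀ ha hα hβ hl
    (finiteSignal_singleton_mem_benchmarks (ha₀.trans_le (ha 1))) hb𝓑 fun A hA => ?_
  set θ₀ := finiteSignal {1} fun j => (a j)⁻¹
  obtain ⟨η, hη, hle⟩ := exists_lintegral_gaussianSeq_le_add (m := b * ⇑θ₀) hv
    (fun j hj => by simp [h, finiteSignal_apply, hj]) hsum
    (measurable_measure_prodMk_left (ν := gaussianSeq b (σ ^ 2).toNNReal) hA)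
    fun y => prob_le_one
  have hη' : ∀ j, (η * g) j ^ 2 = g j ^ 2 := fun j => by
    rw [Pi.mul_apply, mul_pow, hη, one_mul]
  refine ⟨θ₀ + finiteSignal s (η * g), ?_, b, hb𝓥, ?_⟩
  · rw [add_sub_cancel_left]
    refine ⟨finiteSignal_mem_ellipsoid_iff.2 (by simpa only [hη'] using hga), le_of_eq ?_⟩
    rw [← sq_eq_sq₀ (norm_nonneg _) (norm_nonneg _), norm_sq_finiteSignal, norm_sq_finiteSignal]
    simp only [hη']
  · have hmean : b * ⇑(θ₀ + finiteSignal s (η * g)) = b * ⇑θ₀ + η * h := by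
      ext j
      simp only [h, lp.coeFn_add, Pi.add_apply, Pi.mul_apply, finiteSignal_apply]
      split_ifs <;> ring
    rwa [law_eq_prod_gaussianSeq, law_eq_prod_gaussianSeq, Measure.prod_apply hA,
      Measure.prod_apply hA, hmean]

/-- Since `b θ = ν₀ θ₀`, the sequence `Y` has the same law under `(θ₀, ν₀)` and `(θ, b)`. -/
theorem norm_sub_le_minimaxRadius (ha₀ : 0 < a₀) (ha : ∀ j, a₀ ≤ a j) (hα : 0 ≤ α) (hβ : 0 ≤ β)
    (hl : α + β + l < 1) {θ₀ θ : Ell2} (hθ₀ : θ₀ ∈ benchmarks a) (hθ : θ - θ₀ ∈ ellipsoid a)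
    {ν₀ : ℕ+ → ℝ} (hν₀ : ν₀ ∈ 𝓑) (hb : b ∈ 𝓥) (heq : b * ⇑θ = ν₀ * ⇑θ₀) (hσ : 0 < σ)
    (hs : ∀ j ∉ s, b j = ν₀ j) (hsum : ∑ j ∈ s, (b j - ν₀ j) ^ 2 ≤ Real.log (1 + l ^ 2) * σ ^ 2) :
    ‖θ - θ₀‖ ≤ minimaxRadius a 𝓑 𝓥 α β ε σ := by
  refine le_minimaxRadius_of_law_le_add ha₀ ha hα hβ hl hθ₀ hν₀ fun A hA =>
    ⟨θ, ⟨hθ, le_rfl⟩, b, hb, ?_⟩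
  have hv : (σ ^ 2).toNNReal ≠ 0 := (Real.toNNReal_pos.2 (by positivity)).ne'
  have hle := lintegral_gaussianSeq_le_add (m := ν₀) (h := b - ν₀) (s := s) (l := l) hv
    (fun j hj => sub_eq_zero.2 (hs j hj))
    (by
      rw [← Finset.sum_div, Real.coe_toNNReal _ (by positivity), div_le_iff₀ (by positivity)]
      exact hsum)
    (measurable_measure_prodMk_right (μ := gaussianSeq (ν₀ * ⇑θ₀) (ε ^ 2).toNNReal) hA)
    fun x => prob_le_one
  rwa [law_eq_prod_gaussianSeq, law_eq_prod_gaussianSeq, heq, Measure.prod_apply_symm hA,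
    Measure.prod_apply_symm hA, ← add_sub_cancel ν₀ b]

theorem sq_mul_inv_sq_le_minimaxRadius_sq (ha₀ : 0 < a₀) (ha : ∀ j, a₀ ≤ a j) (hα : 0 ≤ α)
    (hβ : 0 ≤ β) (hl : α + β + l < 1) (hb : b ∈ 𝓥) (hσ : 0 < σ) {j : ℕ+} {x : ℝ}
    (hx : x ^ 2 ≤ 1) (hν : Function.update b j (b j * (1 + x)) ∈ 𝓑)
    (hxb : x ^ 2 * b j ^ 2 ≤ Real.log (1 + l ^ 2) * σ ^ 2) :
    x ^ 2 * (a j ^ 2)⁻¹ ≤ minimaxRadius a 𝓑 𝓥 α β ε σ ^ 2 := by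
  have haj : 0 < a j := ha₀.trans_le (ha j)
  set θ₀ := finiteSignal {j} fun j => (a j)⁻¹
  set δ := finiteSignal {j} fun j => x * (a j)⁻¹
  have hδ : ‖δ‖ ^ 2 = x ^ 2 * (a j ^ 2)⁻¹ := by
    rw [norm_sq_finiteSignal, Finset.sum_singleton, mul_pow, inv_pow]
  have hδa : δ ∈ ellipsoid a := by
    rw [finiteSignal_mem_ellipsoid_iff, Finset.sum_singleton]
    calc a j ^ 2 * (x * (a j)⁻¹) ^ 2 = x ^ 2 := by field_simp
      _ ≤ 1 := hx
  have heq : b * ⇑(θ₀ + δ) = Function.update b j (b j * (1 + x)) * ⇑θ₀ := by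
    ext i
    simp only [lp.coeFn_add, Pi.add_apply, Pi.mul_apply, θ₀, δ, finiteSignal_apply,
      Finset.mem_singleton]
    rcases eq_or_ne i j with rfl | hi
    · simp only [if_true, Function.update_self]
      ring
    · simp [hi]
  rw [← hδ, ← add_sub_cancel_left θ₀ δ]
  refine pow_le_pow_left₀ (norm_nonneg _) (norm_sub_le_minimaxRadius (s := {j}) ha₀ ha hα hβ hl
    (finiteSignal_singleton_mem_benchmarks haj) (by rwa [add_sub_cancel_left]) hν hb heq hσ
    (fun i hi => by rw [Function.update_of_ne (Finset.notMem_singleton.1 hi)]) ?_) 2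
  rw [Finset.sum_singleton, Function.update_self]
  linarith

end LowerBounds

section SingularClass

variable {a b : ℕ+ → ℝ} {𝓥 : Set (ℕ+ → ℝ)} {C₀ C₁ α β a₀ : ℝ}

lemma self_mem_singularClass (hb : ∀ j, 0 ≤ b j) (hC₀ : C₀ ≤ 1) (hC₁ : 1 ≤ C₁) :
    b ∈ singularClass b C₀ C₁ := fun j =>
  ⟨mul_le_of_le_one_left (hb j) hC₀, le_mul_of_one_le_left (hb j) hC₁⟩

lemma update_mem_singularClass (hb : ∀ j, 0 ≤ b j) (hC₀ : C₀ ≤ 1) (hC₁ : 1 ≤ C₁) {j : ℕ+} {y : ℝ}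
    (hy : y ∈ Set.Icc C₀ C₁) : Function.update b j (b j * y) ∈ singularClass b C₀ C₁ := fun i => by
  rcases eq_or_ne i j with rfl | hi
  · rw [Function.update_self, mul_comm (b i)]
    exact ⟨mul_le_mul_of_nonneg_right hy.1 (hb i), mul_le_mul_of_nonneg_right hy.2 (hb i)⟩
  · rw [Function.update_of_ne hi]
    exact self_mem_singularClass hb hC₀ hC₁ i

lemma exists_sq_eq_one_add_mem_Icc (hC₀ : C₀ ≤ 1) (hC₁ : 1 ≤ C₁) (hC : C₀ < C₁) :
    ∃ d ∈ Set.Ioc (0 : ℝ) 1, ∀ y ∈ Set.Icc 0 d, ∃ x, x ^ 2 = y ∧ 1 + x ∈ Set.Icc C₀ C₁ := by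
  rcases hC₁.lt_or_eq with hC₁' | rfl
  · refine ⟨min (C₁ - 1) 1 ^ 2, ⟨by have := sub_pos.2 hC₁'; positivity,
      pow_le_one₀ (le_min (sub_nonneg.2 hC₁) zero_le_one) (min_le_right _ _)⟩, fun y hy =>
      ⟨√y, Real.sq_sqrt hy.1, by linarith [Real.sqrt_nonneg y], ?_⟩⟩
    have hsqrt := Real.sqrt_le_iff.2 ⟨le_min (sub_nonneg.2 hC₁) zero_le_one, hy.2⟩
    linarith [min_le_left (C₁ - 1) 1]
  · refine ⟨min (1 - C₀) 1 ^ 2, ⟨by have := sub_pos.2 hC; positivity,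
      pow_le_one₀ (le_min (sub_nonneg.2 hC₀) zero_le_one) (min_le_right _ _)⟩, fun y hy =>
      ⟨-√y, by rw [neg_sq, Real.sq_sqrt hy.1], ?_, by linarith [Real.sqrt_nonneg y]⟩⟩
    have hsqrt := Real.sqrt_le_iff.2 ⟨le_min (sub_nonneg.2 hC₀) zero_le_one, hy.2⟩
    linarith [min_le_left (1 - C₀) 1]

lemma exists_pos_add_lt_one (h : α + β < 1) :
    ∃ l : ℝ≥0, α + β + l < 1 ∧ 0 < Real.log (1 + l ^ 2) := by
  obtain ⟨l, hl, hl'⟩ := exists_between (sub_pos.2 h)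
  lift l to ℝ≥0 using hl.le
  exact ⟨l, by linarith, Real.log_pos (lt_add_of_pos_right 1 (by positivity))⟩

/-- The choice `g j ∝ (b j)⁻²` minimises `∑ (b j * g j) ^ 4` for a given value of `∑ (g j) ^ 2`. -/
lemma exists_sum_sq_eq_and_sum_mul_pow_four_eq {ι : Type*} {s : Finset ι} (hs : s.Nonempty)
    {b : ι → ℝ} (hb : ∀ j, 0 < b j) {x : ℝ} (hx : 0 ≤ x) :
    ∃ g : ι → ℝ, ∑ j ∈ s, g j ^ 2 = x ∧
      ∑ j ∈ s, (b j * g j) ^ 4 = x ^ 2 / ∑ j ∈ s, ((b j ^ 2)⁻¹) ^ 2 := by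
  generalize hS : ∑ j ∈ s, ((b j ^ 2)⁻¹) ^ 2 = S
  have hS₀ : 0 < S := hS ▸ Finset.sum_pos (fun j _ => by have := hb j; positivity) hs
  have hg : ∀ j, (√(x / S) * (b j ^ 2)⁻¹) ^ 2 = x / S * ((b j ^ 2)⁻¹) ^ 2 := fun j => by
    rw [mul_pow, Real.sq_sqrt (by positivity)]
  refine ⟨fun j => √(x / S) * (b j ^ 2)⁻¹, ?_, ?_⟩
  · simp_rw [hg]
    rw [← Finset.mul_sum, hS, div_mul_cancel₀ _ hS₀.ne']
  · calc ∑ j ∈ s, (b j * (√(x / S) * (b j ^ 2)⁻¹)) ^ 4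
        = ∑ j ∈ s, (x / S) ^ 2 * ((b j ^ 2)⁻¹) ^ 2 := by
          refine Finset.sum_congr rfl fun j _ => ?_
          have := (hb j).ne'
          rw [show ∀ y z : ℝ, (y * z) ^ 4 = y ^ 4 * (z ^ 2) ^ 2 from fun y z => by ring, hg]
          field_simp
      _ = x ^ 2 / S := by
          rw [← Finset.mul_sum, hS]
          field_simp

theorem exists_sign_prior_bound (ha₀ : 0 < a₀) (ha : ∀ j, a₀ ≤ a j) (hb : ∀ j, 0 < b j)
    (hα : 0 ≤ α) (hβ : 0 ≤ β) (hαβ : α + β < 1) (hC₀ : C₀ ≤ 1) (hC₁ : 1 ≤ C₁) (hb𝓥 : b ∈ 𝓥) :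
    ∃ c > 0, ∀ ε > 0, ∀ (σ : ℝ) {s : Finset ℕ+}, s.Nonempty → ∀ {ρ : ℝ},
      ρ ≤ ε ^ 2 * √(∑ j ∈ s, ((b j ^ 2)⁻¹) ^ 2) → (∀ j ∈ s, ρ ≤ (a j ^ 2)⁻¹) →
      c * ρ ≤ minimaxRadius a (singularClass b C₀ C₁) 𝓥 α β ε σ ^ 2 := by
  obtain ⟨l, hl, hlog⟩ := exists_pos_add_lt_one hαβ
  set c := min 1 √(2 * Real.log (1 + l ^ 2))
  have hc : 0 < c := by positivity
  refine ⟨c, hc, fun ε hε σ s hs ρ hρb hρa => ?_⟩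
  rcases le_or_gt ρ 0 with hρ | hρ
  · exact (mul_nonpos_of_nonneg_of_nonpos hc.le hρ).trans (sq_nonneg _)
  obtain ⟨g, hg₂, hg₄⟩ := exists_sum_sq_eq_and_sum_mul_pow_four_eq hs hb (mul_pos hc hρ).le
  rw [← hg₂]
  refine sum_sq_le_minimaxRadius_sq ha₀ ha hα hβ hl
    (self_mem_singularClass (fun j => (hb j).le) hC₀ hC₁) hb𝓥 hε ?_ ?_
  · calc ∑ j ∈ s, a j ^ 2 * g j ^ 2 ≤ ∑ j ∈ s, ρ⁻¹ * g j ^ 2 := by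
          refine Finset.sum_le_sum fun j hj => mul_le_mul_of_nonneg_right ?_ (sq_nonneg _)
          have := ha₀.trans_le (ha j)
          exact (le_inv_comm₀ hρ (by positivity)).1 (hρa j hj)
      _ = c := by rw [← Finset.mul_sum, hg₂]; field_simp
      _ ≤ 1 := min_le_left _ _
  · rw [hg₄]
    have hS : 0 < ∑ j ∈ s, ((b j ^ 2)⁻¹) ^ 2 :=
      Finset.sum_pos (fun j _ => by have := hb j; positivity) hs
    rw [div_le_iff₀ hS]
    calc (c * ρ) ^ 2 = c ^ 2 * ρ ^ 2 := mul_pow _ _ _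
      _ ≤ (2 * Real.log (1 + l ^ 2)) * (ε ^ 2 * √(∑ j ∈ s, ((b j ^ 2)⁻¹) ^ 2)) ^ 2 := by
          gcongr
          exact (Real.le_sqrt hc.le (by positivity)).1 (min_le_right _ _)
      _ = 2 * Real.log (1 + l ^ 2) * ε ^ 4 * ∑ j ∈ s, ((b j ^ 2)⁻¹) ^ 2 := by
          rw [mul_pow, Real.sq_sqrt hS.le]
          ring

theorem exists_unknown_operator_bound (ha₀ : 0 < a₀) (ha : ∀ j, a₀ ≤ a j) (hb : ∀ j, 0 < b j)
    (hα : 0 ≤ α) (hβ : 0 ≤ β) (hαβ : α + β < 1) (hC₀ : C₀ ≤ 1) (hC₁ : 1 ≤ C₁) (hC : C₀ < C₁)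
    (hb𝓥 : b ∈ 𝓥) :
    ∃ c > 0, ∀ (ε : ℝ), ∀ σ > 0, ∀ j, c * (min (σ ^ 2 * (b j ^ 2)⁻¹) 1 * (a j ^ 2)⁻¹) ≤
      minimaxRadius a (singularClass b C₀ C₁) 𝓥 α β ε σ ^ 2 := by
  obtain ⟨l, hl, hlog⟩ := exists_pos_add_lt_one hαβ
  obtain ⟨d, ⟨hd, hd₁⟩, hx⟩ := exists_sq_eq_one_add_mem_Icc hC₀ hC₁ hC
  have hc : 0 < min d (Real.log (1 + l ^ 2)) := lt_min hd hlog
  refine ⟨_, hc, fun ε σ hσ j => ?_⟩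
  have hbj : 0 < b j := hb j
  obtain ⟨x, hx₂, hxC⟩ := hx (min d (Real.log (1 + l ^ 2)) * min (σ ^ 2 * (b j ^ 2)⁻¹) 1)
    ⟨by positivity, (mul_le_of_le_one_right hc.le (min_le_right _ _)).trans (min_le_left _ _)⟩
  rw [← mul_assoc, ← hx₂]
  refine sq_mul_inv_sq_le_minimaxRadius_sq ha₀ ha hα hβ hl hb𝓥 hσ ?_
    (update_mem_singularClass (fun i => (hb i).le) hC₀ hC₁ hxC) ?_
  · exact hx₂ ▸ mul_le_one₀ ((min_le_left _ _).trans hd₁) (by positivity) (min_le_right _ _)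
  · calc x ^ 2 * b j ^ 2 ≤ Real.log (1 + l ^ 2) * (σ ^ 2 * (b j ^ 2)⁻¹) * b j ^ 2 := by
          rw [hx₂]
          gcongr <;> simp
      _ = Real.log (1 + l ^ 2) * σ ^ 2 := by field_simp

end SingularClass

section Scales

/-- A sequence `E ≥ 1` which meets every interval `[x, C x]` with `x ≥ 1`, for some constant `C`.
Polynomial and exponential sequences are the powers of the scales `j` and `exp j`. -/
structure IsScale (E : ℕ+ → ℝ) : Prop where
  one_le : ∀ j, 1 ≤ E j
  exists_between : ∃ C > 0, ∀ x ≥ 1, ∃ j, x ≤ E j ∧ E j ≤ C * x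

variable {E F a b c d : ℕ+ → ℝ} {s t : ℝ}

lemma IsScale.pos (hE : IsScale E) (j : ℕ+) : 0 < E j := one_pos.trans_le (hE.one_le j)

lemma exists_pnat_between {x : ℝ} (hx : 0 ≤ x) :
    ∃ n : ℕ+, x ≤ ((n : ℕ) : ℝ) ∧ ((n : ℕ) : ℝ) ≤ x + 1 := by
  refine ⟨Nat.succPNat ⌊x⌋₊, ?_, ?_⟩ <;> rw [Nat.succPNat_coe, Nat.cast_succ]
  · exact (Nat.lt_floor_add_one x).le
  · gcongr
    exact Nat.floor_le hx

lemma isScale_natCast : IsScale fun j => ((j : ℕ) : ℝ) where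
  one_le j := Nat.one_le_cast.2 j.pos
  exists_between := ⟨2, two_pos, fun x hx => by
    obtain ⟨n, hn, hn'⟩ := exists_pnat_between (zero_le_one.trans hx)
    exact ⟨n, hn, by linarith⟩⟩

lemma isScale_exp : IsScale fun j => Real.exp ((j : ℕ) : ℝ) where
  one_le j := Real.one_le_exp (Nat.cast_nonneg _)
  exists_between := ⟨Real.exp 1, Real.exp_pos 1, fun x hx => by
    have hx₀ : 0 < x := one_pos.trans_le hx
    obtain ⟨n, hn, hn'⟩ := exists_pnat_between (Real.log_nonneg hx)
    refine ⟨n, (Real.log_le_iff_le_exp hx₀).1 hn, (Real.exp_le_exp.2 hn').trans_eq ?_⟩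
    rw [Real.exp_add, Real.exp_log hx₀, mul_comm]⟩

lemma Comparable.exists_mul_le (h : Comparable c d) (hd : ∀ j, 0 < d j) :
    ∃ k > 0, ∀ j, k * d j ≤ c j :=
  let ⟨κ₀, _, h₀, _, h⟩ := h
  ⟨κ₀, h₀, fun j => (le_div_iff₀ (hd j)).1 (h j).1⟩

lemma Comparable.pos (h : Comparable c d) (hd : ∀ j, 0 < d j) (j : ℕ+) : 0 < c j :=
  let ⟨_, hk, h⟩ := h.exists_mul_le hd
  (mul_pos hk (hd j)).trans_le (h j)

lemma Comparable.exists_mul_inv_sq_le (h : Comparable c d) (hd : ∀ j, 0 < d j) :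
    ∃ k > 0, ∀ j, k * (d j ^ 2)⁻¹ ≤ (c j ^ 2)⁻¹ := by
  have hc := h.pos hd
  obtain ⟨κ₀, κ₁, h₀, h₁, h⟩ := h
  have hκ₁ : 0 < κ₁ := h₀.trans_le h₁
  refine ⟨(κ₁ ^ 2)⁻¹, by positivity, fun j => ?_⟩
  rw [← mul_inv, ← mul_pow]
  have := hc j
  gcongr
  exact (div_le_iff₀ (hd j)).1 (h j).2

lemma Comparable.exists_mul_rpow_le_inv_sq (h : Comparable a fun j => E j ^ s)
    (hE : ∀ j, 0 < E j) (hs : 0 ≤ s) {C : ℝ} (hC : 0 < C) :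
    ∃ k > 0, ∀ j y, E j ≤ C * y → k * y ^ (-2 * s) ≤ (a j ^ 2)⁻¹ := by
  obtain ⟨k, hk, h⟩ := h.exists_mul_inv_sq_le fun j => Real.rpow_pos_of_pos (hE j) s
  refine ⟨k * C ^ (-2 * s), by positivity, fun j y hy => ?_⟩
  have hy₀ : 0 < y := pos_of_mul_pos_right ((hE j).trans_le hy) hC.le
  calc k * C ^ (-2 * s) * y ^ (-2 * s) = k * (C * y) ^ (-2 * s) := by
        rw [mul_assoc, Real.mul_rpow hC.le hy₀.le]
    _ ≤ k * E j ^ (-2 * s) :=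
        mul_le_mul_of_nonneg_left (Real.rpow_le_rpow_of_nonpos (hE j) hy (by linarith)) hk.le
    _ = k * ((E j ^ s) ^ 2)⁻¹ := by
        rw [← Real.rpow_mul_natCast (hE j).le, ← Real.rpow_neg (hE j).le, Nat.cast_ofNat,
          neg_mul, mul_comm s]
    _ ≤ (a j ^ 2)⁻¹ := h j

lemma Comparable.exists_mul_sq_rpow_le_inv_sq (h : Comparable b fun j => F j ^ (-t))
    (hF : ∀ j, 0 < F j) : ∃ k > 0, ∀ j, k * (F j ^ t) ^ 2 ≤ (b j ^ 2)⁻¹ := by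
  obtain ⟨k, hk, h⟩ := h.exists_mul_inv_sq_le fun j => Real.rpow_pos_of_pos (hF j) (-t)
  refine ⟨k, hk, fun j => ?_⟩
  simpa only [Real.rpow_neg (hF j).le, inv_pow, inv_inv] using h j

lemma Comparable.exists_mul_rpow_le_sqrt_sum (h : Comparable b fun j => ((j : ℕ) : ℝ) ^ (-t))
    (ht : 0 ≤ t) : ∃ k > 0, ∀ m : ℕ+, k * ((m : ℕ) : ℝ) ^ (2 * t + 1 / 2) ≤
      √(∑ j ∈ Finset.Icc m (2 * m), ((b j ^ 2)⁻¹) ^ 2) := by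
  obtain ⟨k, hk, h⟩ := h.exists_mul_sq_rpow_le_inv_sq isScale_natCast.pos
  refine ⟨k, hk, fun m => Real.le_sqrt_of_sq_le ?_⟩
  have hm : (0 : ℝ) < (m : ℕ) := isScale_natCast.pos m
  have hcard : ((m : ℕ) : ℝ) ≤ (Finset.Icc m (2 * m)).card := by
    rw [PNat.card_Icc, Nat.cast_le, PNat.mul_coe, PNat.val_ofNat]
    lia
  calc (k * ((m : ℕ) : ℝ) ^ (2 * t + 1 / 2)) ^ 2
      = (m : ℕ) * (k * (((m : ℕ) : ℝ) ^ t) ^ 2) ^ 2 := by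
        rw [Real.rpow_add hm, ← Real.sqrt_eq_rpow, mul_comm 2 t, Real.rpow_mul hm.le,
          Real.rpow_two, ← mul_assoc, mul_pow, Real.sq_sqrt hm.le, mul_comm]
    _ ≤ (Finset.Icc m (2 * m)).card * (k * (((m : ℕ) : ℝ) ^ t) ^ 2) ^ 2 := by gcongr
    _ = ∑ _j ∈ Finset.Icc m (2 * m), (k * (((m : ℕ) : ℝ) ^ t) ^ 2) ^ 2 := by
        rw [Finset.sum_const, nsmul_eq_mul]
    _ ≤ ∑ j ∈ Finset.Icc m (2 * m), ((b j ^ 2)⁻¹) ^ 2 := by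
        refine Finset.sum_le_sum fun j hj => ?_
        have hmj : ((m : ℕ) : ℝ) ≤ (j : ℕ) := by exact_mod_cast (Finset.mem_Icc.1 hj).1
        gcongr
        exact le_trans (by gcongr) (h j)

end Scales

section Rates

variable {E F a b : ℕ+ → ℝ} {ρ w : ℝ → ℝ} {s t C k : ℝ}

/-- `ρ ε` is, up to a constant and for small `ε`, a lower bound provided by a prior of random signs
on some finite set of coordinates, in the form required by `exists_sign_prior_bound`. -/
def IsSignPriorRate (a b : ℕ+ → ℝ) (ρ : ℝ → ℝ) : Prop :=
  ∃ κ > 0, ∀ ε ∈ Set.Ioc 0 (Real.exp (-1)), ∃ s : Finset ℕ+, s.Nonempty ∧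
    κ * ρ ε ≤ ε ^ 2 * √(∑ j ∈ s, ((b j ^ 2)⁻¹) ^ 2) ∧ ∀ j ∈ s, κ * ρ ε ≤ (a j ^ 2)⁻¹

/-- `ρ σ` is, up to a constant and for small `σ`, a lower bound provided by a perturbation of a
single unknown singular value, in the form required by `exists_unknown_operator_bound`. -/
def IsOperatorRate (a b : ℕ+ → ℝ) (ρ : ℝ → ℝ) : Prop :=
  ∃ κ > 0, ∀ σ ∈ Set.Ioc 0 (Real.exp (-1)), ∃ j,
    κ * ρ σ ≤ min (σ ^ 2 * (b j ^ 2)⁻¹) 1 * (a j ^ 2)⁻¹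

lemma min_mul_max_le {p q x y z : ℝ} (hp : 0 ≤ p) (hq : 0 ≤ q) (hz : 0 ≤ z) (hx : p * x ≤ z)
    (hy : q * y ≤ z) : min p q * max x y ≤ z := by
  rcases le_total (max x y) 0 with h | h
  · exact (mul_nonpos_of_nonneg_of_nonpos (le_min hp hq) h).trans hz
  · rcases max_choice x y with hxy | hxy <;> rw [hxy] at h ⊢
    · exact (mul_le_mul_of_nonneg_right (min_le_left p q) h).trans hx
    · exact (mul_le_mul_of_nonneg_right (min_le_right p q) h).trans hy

theorem gtrsimSmallNoise_minimaxRadius {𝓥 : Set (ℕ+ → ℝ)} {C₀ C₁ α β : ℝ} (hE : IsScale E)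
    (hF : IsScale F) (hs : 0 ≤ s) (ha : Comparable a fun j => E j ^ s)
    (hb : Comparable b fun j => F j ^ (-t)) (hα : 0 ≤ α) (hβ : 0 ≤ β) (hαβ : α + β < 1)
    (hC₀ : C₀ ≤ 1) (hC₁ : 1 ≤ C₁) (hC : C₀ < C₁) (hb𝓥 : b ∈ 𝓥) {ρ₁ ρ₂ : ℝ → ℝ}
    (h₁ : IsSignPriorRate a b ρ₁) (h₂ : IsOperatorRate a b ρ₂) :
    GtrsimSmallNoise (fun ε σ => minimaxRadius a (singularClass b C₀ C₁) 𝓥 α β ε σ ^ 2)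
      (fun ε σ => max (ρ₁ ε) (ρ₂ σ)) := by
  obtain ⟨a₀, ha₀, ha⟩ := ha.exists_mul_le fun j => Real.rpow_pos_of_pos (hE.pos j) s
  replace ha : ∀ j, a₀ ≤ a j := fun j =>
    (le_mul_of_one_le_right ha₀.le (Real.one_le_rpow (hE.one_le j) hs)).trans (ha j)
  replace hb := hb.pos fun j => Real.rpow_pos_of_pos (hF.pos j) (-t)
  obtain ⟨c₁, hc₁, H₁⟩ := exists_sign_prior_bound ha₀ ha hb hα hβ hαβ hC₀ hC₁ hb𝓥
  obtain ⟨c₂, hc₂, H₂⟩ := exists_unknown_operator_bound ha₀ ha hb hα hβ hαβ hC₀ hC₁ hC hb𝓥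
  obtain ⟨κ₁, hκ₁, h₁⟩ := h₁
  obtain ⟨κ₂, hκ₂, h₂⟩ := h₂
  have he : Real.exp (-1) ∈ Set.Ioo (0 : ℝ) 1 := ⟨Real.exp_pos _, by simp⟩
  refine ⟨_, he, _, he, min (c₁ * κ₁) (c₂ * κ₂), by positivity, fun ε σ hε hε' hσ hσ' => ?_⟩
  obtain ⟨s, hs, hsb, hsa⟩ := h₁ ε ⟨hε, hε'⟩
  obtain ⟨j, hj⟩ := h₂ σ ⟨hσ, hσ'⟩
  refine min_mul_max_le (by positivity) (by positivity) (sq_nonneg _) ?_ ?_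
  · rw [mul_assoc]
    exact H₁ ε hε σ hs hsb hsa
  · rw [mul_assoc]
    exact (mul_le_mul_of_nonneg_left hj hc₂.le).trans (H₂ ε σ hσ j)

lemma isSignPriorRate_of_exists_finset (hE : IsScale E) (hs : 0 ≤ s)
    (ha : Comparable a fun j => E j ^ s) (hC : 0 < C) (hk : 0 < k)
    (h : ∀ ε ∈ Set.Ioc 0 (Real.exp (-1)), 0 ≤ ρ ε ∧ k * ρ ε ≤ w ε ^ (-2 * s) ∧ ∃ S : Finset ℕ+,
      S.Nonempty ∧ k * ρ ε ≤ ε ^ 2 * √(∑ j ∈ S, ((b j ^ 2)⁻¹) ^ 2) ∧ ∀ j ∈ S, E j ≤ C * w ε) :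
    IsSignPriorRate a b ρ := by
  obtain ⟨k', hk', ha⟩ := ha.exists_mul_rpow_le_inv_sq hE.pos hs hC
  refine ⟨min 1 k' * k, by positivity, fun ε hε => ?_⟩
  obtain ⟨hρ, hρw, S, hS, hSb, hSa⟩ := h ε hε
  refine ⟨S, hS, ?_, fun j hj => ?_⟩ <;> rw [mul_assoc]
  · exact (mul_le_of_le_one_left (by positivity) (min_le_left _ _)).trans hSb
  · calc min 1 k' * (k * ρ ε) ≤ k' * w ε ^ (-2 * s) :=
          mul_le_mul (min_le_right _ _) hρw (by positivity) hk'.le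
      _ ≤ (a j ^ 2)⁻¹ := ha j _ (hSa j hj)

lemma isSignPriorRate_of_exists_index (hE : IsScale E) (hF : IsScale F) (hs : 0 ≤ s)
    (ha : Comparable a fun j => E j ^ s) (hb : Comparable b fun j => F j ^ (-t)) (hC : 0 < C)
    (hρ : ∀ ε > 0, ρ ε = w ε ^ (-2 * s))
    (h : ∀ ε ∈ Set.Ioc 0 (Real.exp (-1)), ∃ j, w ε ^ (-s) ≤ ε * F j ^ t ∧ E j ≤ C * w ε) :
    IsSignPriorRate a b ρ := by
  obtain ⟨k, hk, hb⟩ := hb.exists_mul_sq_rpow_le_inv_sq hF.pos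
  refine isSignPriorRate_of_exists_finset hE hs ha hC (k := min k 1) (w := w) (by positivity)
    fun ε hε => ?_
  obtain ⟨j, hj, hjC⟩ := h ε hε
  rw [hρ ε hε.1]
  have hw : 0 < w ε := pos_of_mul_pos_right ((hE.pos j).trans_le hjC) hC.le
  refine ⟨by positivity, mul_le_of_le_one_left (by positivity) (min_le_right _ _), {j},
    Finset.singleton_nonempty j, ?_, by simpa using hjC⟩
  rw [Finset.sum_singleton, Real.sqrt_sq (by positivity)]
  calc min k 1 * w ε ^ (-2 * s) ≤ k * (w ε ^ (-s)) ^ 2 := by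
        rw [← Real.rpow_mul_natCast hw.le, Nat.cast_ofNat, neg_mul_comm, mul_comm 2]
        gcongr
        exact min_le_left _ _
    _ ≤ k * (ε * F j ^ t) ^ 2 := by gcongr
    _ = ε ^ 2 * (k * (F j ^ t) ^ 2) := by ring
    _ ≤ ε ^ 2 * (b j ^ 2)⁻¹ := by gcongr; exact hb j

lemma isOperatorRate_of_exists_index (hE : IsScale E) (hF : IsScale F) (hs : 0 ≤ s)
    (ha : Comparable a fun j => E j ^ s) (hb : Comparable b fun j => F j ^ (-t)) (hC : 0 < C)
    (hρ : ∀ σ > 0, ρ σ = w σ ^ (-2 * s))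
    (h : ∀ σ ∈ Set.Ioc 0 (Real.exp (-1)), ∃ j, 1 ≤ σ * F j ^ t ∧ E j ≤ C * w σ) :
    IsOperatorRate a b ρ := by
  obtain ⟨k, hk, ha⟩ := ha.exists_mul_rpow_le_inv_sq hE.pos hs hC
  obtain ⟨k', hk', hb⟩ := hb.exists_mul_sq_rpow_le_inv_sq hF.pos
  refine ⟨min k' 1 * k, by positivity, fun σ hσ => ?_⟩
  obtain ⟨j, hj, hjC⟩ := h σ hσ
  have hw : 0 < w σ := pos_of_mul_pos_right ((hE.pos j).trans_le hjC) hC.le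
  refine ⟨j, ?_⟩
  rw [hρ σ hσ.1, mul_assoc]
  refine mul_le_mul (min_le_min_right 1 ?_) (ha j _ hjC) (by positivity) (by positivity)
  calc k' ≤ k' * (σ * F j ^ t) ^ 2 := le_mul_of_one_le_right hk'.le (one_le_pow₀ hj)
    _ = σ ^ 2 * (k' * (F j ^ t) ^ 2) := by ring
    _ ≤ σ ^ 2 * (b j ^ 2)⁻¹ := by gcongr; exact hb j

lemma isOperatorRate_sq (ha : a 1 ≠ 0) (hb : b 1 ≠ 0) : IsOperatorRate a b fun σ => σ ^ 2 := by
  refine ⟨min (b 1 ^ 2)⁻¹ 1 * (a 1 ^ 2)⁻¹, by positivity, fun σ ⟨hσ, hσ'⟩ => ⟨1, ?_⟩⟩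
  have hσ₁ : σ ^ 2 ≤ 1 := pow_le_one₀ hσ.le (hσ'.trans (by simp))
  rw [mul_right_comm]
  gcongr
  rw [mul_comm, mul_min_of_nonneg _ _ (sq_nonneg σ), mul_one]
  exact min_le_min_left _ hσ₁

lemma one_le_log_one_div {ε : ℝ} (hε : ε ∈ Set.Ioc 0 (Real.exp (-1))) : 1 ≤ Real.log (1 / ε) := by
  rw [one_div, Real.log_inv, le_neg]
  exact (Real.log_le_iff_le_exp hε.1).2 hε.2

lemma one_le_rpow_neg {ε x : ℝ} (hε : ε ∈ Set.Ioc 0 (Real.exp (-1))) (hx : 0 ≤ x) :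
    1 ≤ ε ^ (-x) :=
  Real.one_le_rpow_of_pos_of_le_one_of_nonpos hε.1 (hε.2.trans (by simp)) (neg_nonpos.2 hx)

theorem isOperatorRate_rpow_min (hE : IsScale E) (hs : 0 ≤ s) (ht : 0 < t)
    (ha : Comparable a fun j => E j ^ s) (hb : Comparable b fun j => E j ^ (-t)) :
    IsOperatorRate a b fun σ => σ ^ (2 * min (s / t) 1) := by
  rcases le_total (s / t) 1 with hst | hst
  · simp only [min_eq_left hst]
    obtain ⟨C, hC, hEC⟩ := hE.exists_between
    refine isOperatorRate_of_exists_index (w := fun σ => σ ^ (-t⁻¹)) hE hE hs ha hb hC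
      (fun σ hσ => ?_) fun σ hσ => ?_
    · rw [← Real.rpow_mul (le_of_lt hσ)]
      ring_nf
    · have hσ₀ := hσ.1
      obtain ⟨j, hj, hj'⟩ := hEC _ (one_le_rpow_neg hσ (inv_nonneg.2 ht.le))
      refine ⟨j, ?_, hj'⟩
      calc 1 = σ * (σ ^ (-t⁻¹)) ^ t := by
            rw [← Real.rpow_mul hσ₀.le, neg_mul, inv_mul_cancel₀ ht.ne', Real.rpow_neg_one,
              mul_inv_cancel₀ hσ₀.ne']
        _ ≤ σ * E j ^ t := by gcongr
  · simp only [min_eq_right hst, mul_one, Real.rpow_two]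
    exact isOperatorRate_sq (ha.pos (fun j => Real.rpow_pos_of_pos (hE.pos j) s) 1).ne'
      (hb.pos (fun j => Real.rpow_pos_of_pos (hE.pos j) (-t)) 1).ne'

theorem isSignPriorRate_rpow (hE : IsScale E) (hs : 0 ≤ s) (ht : 0 < t)
    (ha : Comparable a fun j => E j ^ s) (hb : Comparable b fun j => E j ^ (-t)) :
    IsSignPriorRate a b fun ε => ε ^ (2 * s / (s + t)) := by
  obtain ⟨C, hC, hEC⟩ := hE.exists_between
  have hst : 0 < s + t := add_pos_of_nonneg_of_pos hs ht
  refine isSignPriorRate_of_exists_index (w := fun ε => ε ^ (-(s + t)⁻¹)) hE hE hs ha hb hC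
    (fun ε hε => ?_) fun ε hε => ?_
  · rw [← Real.rpow_mul (le_of_lt hε)]
    ring_nf
  · have hε₀ := hε.1
    obtain ⟨j, hj, hj'⟩ := hEC _ (one_le_rpow_neg hε (inv_nonneg.2 hst.le))
    refine ⟨j, ?_, hj'⟩
    calc (ε ^ (-(s + t)⁻¹)) ^ (-s) = ε * (ε ^ (-(s + t)⁻¹)) ^ t := by
          rw [← Real.rpow_mul hε₀.le, ← Real.rpow_mul hε₀.le, mul_comm ε,
            ← Real.rpow_add_one hε₀.ne']
          congr 1
          field_simp
          ring
      _ ≤ ε * E j ^ t := by gcongr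

lemma exists_index_log (ht : 0 < t) {ε : ℝ} (hε : ε ∈ Set.Ioc 0 (Real.exp (-1))) :
    ∃ j : ℕ+, 1 ≤ ε * Real.exp ((j : ℕ) : ℝ) ^ t ∧
      ((j : ℕ) : ℝ) ≤ (1 / t + 1) * Real.log (1 / ε) := by
  have hL := one_le_log_one_div hε
  have hε₀ := hε.1
  obtain ⟨j, hj, hj'⟩ := exists_pnat_between (x := Real.log (1 / ε) / t) (by positivity)
  refine ⟨j, ?_, by linear_combination hj' + hL⟩
  calc 1 = ε * Real.exp (Real.log (1 / ε)) := by
        rw [Real.exp_log (by positivity), mul_one_div_cancel hε₀.ne']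
    _ ≤ ε * Real.exp ((j : ℕ) : ℝ) ^ t := by
        rw [← Real.exp_mul]
        gcongr
        exact (div_le_iff₀ ht).1 hj

theorem isSignPriorRate_log (hs : 0 ≤ s) (ht : 0 < t)
    (ha : Comparable a fun j => ((j : ℕ) : ℝ) ^ s)
    (hb : Comparable b fun j => Real.exp ((j : ℕ) : ℝ) ^ (-t)) :
    IsSignPriorRate a b fun ε => Real.log (1 / ε) ^ (-2 * s) :=
  isSignPriorRate_of_exists_index isScale_natCast isScale_exp hs ha hb (by positivity)
    (fun _ _ => rfl) fun _ hε =>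
      let ⟨j, hj, hj'⟩ := exists_index_log ht hε
      ⟨j, (Real.rpow_le_one_of_one_le_of_nonpos (one_le_log_one_div hε)
        (neg_nonpos.2 hs)).trans hj, hj'⟩

theorem isOperatorRate_log (hs : 0 ≤ s) (ht : 0 < t)
    (ha : Comparable a fun j => ((j : ℕ) : ℝ) ^ s)
    (hb : Comparable b fun j => Real.exp ((j : ℕ) : ℝ) ^ (-t)) :
    IsOperatorRate a b fun σ => Real.log (1 / σ) ^ (-2 * s) :=
  isOperatorRate_of_exists_index isScale_natCast isScale_exp hs ha hb (by positivity)
    (fun _ _ => rfl) fun _ hσ => exists_index_log ht hσ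

lemma nonempty_Icc_self_two_mul (m : ℕ+) : (Finset.Icc m (2 * m)).Nonempty :=
  Finset.nonempty_Icc.2 (PNat.coe_le_coe _ _ |>.1 (by rw [PNat.mul_coe, PNat.val_ofNat]; lia))

lemma natCast_le_of_mem_Icc_two_mul {m j : ℕ+} (hj : j ∈ Finset.Icc m (2 * m)) :
    ((j : ℕ) : ℝ) ≤ 2 * (m : ℕ) := by
  exact_mod_cast (Finset.mem_Icc.1 hj).2

/-- The block `[m, 2m]` with `m ≈ ε ^ (-2 / q)`, `q = 2s + 2t + 1/2`, balances the two bounds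
`ε² m ^ (2t + 1/2)` and `m ^ (-2s)`. -/
theorem isSignPriorRate_of_rpow_of_rpow (hs : 0 ≤ s) (ht : 0 ≤ t)
    (ha : Comparable a fun j => ((j : ℕ) : ℝ) ^ s)
    (hb : Comparable b fun j => ((j : ℕ) : ℝ) ^ (-t)) :
    IsSignPriorRate a b fun ε => ε ^ (4 * s / (2 * s + 2 * t + 1 / 2)) := by
  obtain ⟨k, hk, hb⟩ := hb.exists_mul_rpow_le_sqrt_sum ht
  set q := 2 * s + 2 * t + 1 / 2 with hq
  have hq₀ : 0 < q := by positivity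
  refine isSignPriorRate_of_exists_finset (w := fun ε => ε ^ (-(2 / q))) (C := 4) (k := min k 1)
    isScale_natCast hs ha (by positivity) (by positivity) fun ε hε => ?_
  have hε₀ := hε.1
  have hx := one_le_rpow_neg hε (x := 2 / q) (by positivity)
  obtain ⟨m, hm, hm'⟩ := exists_pnat_between (zero_le_one.trans hx)
  refine ⟨by positivity, ?_, Finset.Icc m (2 * m), nonempty_Icc_self_two_mul m, ?_, fun j hj => ?_⟩
  · rw [← Real.rpow_mul hε₀.le, show -(2 / q) * (-2 * s) = 4 * s / q by ring]
    exact mul_le_of_le_one_left (by positivity) (min_le_right _ _)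
  · calc min k 1 * ε ^ (4 * s / q) ≤ k * ε ^ (4 * s / q) := by
          gcongr
          exact min_le_left _ _
      _ = ε ^ 2 * (k * (ε ^ (-(2 / q))) ^ (2 * t + 1 / 2)) := by
          rw [← Real.rpow_mul hε₀.le, mul_left_comm, ← Real.rpow_two, ← Real.rpow_add hε₀]
          congr 2
          field_simp
          linear_combination -2 * hq
      _ ≤ ε ^ 2 * (k * ((m : ℕ) : ℝ) ^ (2 * t + 1 / 2)) := by gcongr
      _ ≤ _ := by
          gcongr
          exact hb m
  · linarith [natCast_le_of_mem_Icc_two_mul hj]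

lemma rpow_le_rpow_mul_exp {q x : ℝ} (hq : 0 < q) (hx : 0 ≤ x) :
    x ^ q ≤ q ^ q * Real.exp x := by
  have h : x / q ≤ Real.exp (x / q) := by linarith [Real.add_one_le_exp (x / q)]
  calc x ^ q = q ^ q * (x / q) ^ q := by
        rw [← Real.mul_rpow hq.le (by positivity), mul_div_cancel₀ _ hq.ne']
    _ ≤ q ^ q * Real.exp (x / q) ^ q := by gcongr
    _ = q ^ q * Real.exp x := by rw [← Real.exp_mul, div_mul_cancel₀ _ hq.ne']

/-- On the block `[m, 2m]` with `m ≈ log (1 / ε) / (4s)` the bound `exp (-2s · 2m) ≈ ε` from the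
ellipsoid is larger than `ε² m ^ (2t + 1/2)`. -/
theorem isSignPriorRate_of_exp_of_rpow (hs : 0 < s) (ht : 0 ≤ t)
    (ha : Comparable a fun j => Real.exp ((j : ℕ) : ℝ) ^ s)
    (hb : Comparable b fun j => ((j : ℕ) : ℝ) ^ (-t)) :
    IsSignPriorRate a b fun ε => ε ^ 2 * Real.log (1 / ε) ^ (2 * t + 1 / 2) := by
  obtain ⟨k, hk, hb⟩ := hb.exists_mul_rpow_le_sqrt_sum ht
  set q := 2 * t + 1 / 2
  have hq : 0 < q := by positivity
  refine isSignPriorRate_of_exists_finset (w := fun ε => Real.exp (Real.log (1 / ε) / (2 * s)))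
    (C := Real.exp 2) (k := min (k * ((4 * s) ^ q)⁻¹) (q ^ q)⁻¹)
    isScale_exp hs.le ha (by positivity) (by positivity) fun ε hε => ?_
  have hε₀ := hε.1
  have hL := one_le_log_one_div hε
  set L := Real.log (1 / ε)
  obtain ⟨m, hm, hm'⟩ := exists_pnat_between (x := L / (4 * s)) (by positivity)
  refine ⟨by positivity, ?_, Finset.Icc m (2 * m), nonempty_Icc_self_two_mul m, ?_, fun j hj => ?_⟩
  · have hexp : Real.exp L = 1 / ε := Real.exp_log (by positivity)
    calc min (k * ((4 * s) ^ q)⁻¹) (q ^ q)⁻¹ * (ε ^ 2 * L ^ q)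
        ≤ (q ^ q)⁻¹ * (ε ^ 2 * (q ^ q * Real.exp L)) := by
          gcongr
          · exact min_le_right _ _
          · exact rpow_le_rpow_mul_exp hq (by positivity)
      _ = Real.exp (-L) := by rw [Real.exp_neg, hexp]; field_simp
      _ = Real.exp (L / (2 * s)) ^ (-2 * s) := by rw [← Real.exp_mul]; congr 1; field_simp
  · calc min (k * ((4 * s) ^ q)⁻¹) (q ^ q)⁻¹ * (ε ^ 2 * L ^ q)
        ≤ k * ((4 * s) ^ q)⁻¹ * (ε ^ 2 * L ^ q) := by
          gcongr
          exact min_le_left _ _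
      _ = ε ^ 2 * (k * (L / (4 * s)) ^ q) := by
          rw [Real.div_rpow (by positivity) (by positivity)]
          ring
      _ ≤ ε ^ 2 * (k * ((m : ℕ) : ℝ) ^ q) := by gcongr
      _ ≤ _ := by
          gcongr
          exact hb m
  · rw [← Real.exp_add]
    gcongr
    calc ((j : ℕ) : ℝ) ≤ 2 * (L / (4 * s) + 1) := by
          linarith [natCast_le_of_mem_Icc_two_mul hj]
      _ = 2 + L / (2 * s) := by ring

end Rates

end NoisyGSM

end

open NoisyGSM in
theorem theorem5_general {α β s t C₀ C₁ : ℝ} (hα : 0 ≤ α) (hβ : 0 ≤ β) (hαβ : α + β < 1)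
    (hs : 0 < s) (ht : 0 < t) {a b : ℕ+ → ℝ} (hC₀ : C₀ ≤ 1) (hC₁ : 1 ≤ C₁) (hC : C₀ < C₁)
    {𝓥 : Set (ℕ+ → ℝ)} (hb𝓥 : b ∈ 𝓥) :
    (Comparable b (fun j => ((j : ℕ) : ℝ) ^ (-t)) →
      Comparable a (fun j => ((j : ℕ) : ℝ) ^ s) →
      GtrsimSmallNoise
        (fun ε σ => minimaxRadius a (singularClass b C₀ C₁) 𝓥 α β ε σ ^ 2)
        (fun ε σ => max (ε ^ (4 * s / (2 * s + 2 * t + 1 / 2))) (σ ^ (2 * min (s / t) 1)))) ∧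
    (Comparable b (fun j => ((j : ℕ) : ℝ) ^ (-t)) →
      Comparable a (fun j => Real.exp (((j : ℕ) : ℝ) * s)) →
      GtrsimSmallNoise
        (fun ε σ => minimaxRadius a (singularClass b C₀ C₁) 𝓥 α β ε σ ^ 2)
        (fun ε σ => max (ε ^ 2 * Real.log (1 / ε) ^ (2 * t + 1 / 2)) (σ ^ 2))) ∧
    (Comparable b (fun j => Real.exp (-(((j : ℕ) : ℝ) * t))) →
      Comparable a (fun j => ((j : ℕ) : ℝ) ^ s) →
      GtrsimSmallNoise
        (fun ε σ => minimaxRadius a (singularClass b C₀ C₁) 𝓥 α β ε σ ^ 2)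
        (fun ε σ => max (Real.log (1 / ε) ^ (-2 * s)) (Real.log (1 / σ) ^ (-2 * s)))) ∧
    (Comparable b (fun j => Real.exp (-(((j : ℕ) : ℝ) * t))) →
      Comparable a (fun j => Real.exp (((j : ℕ) : ℝ) * s)) →
      GtrsimSmallNoise
        (fun ε σ => minimaxRadius a (singularClass b C₀ C₁) 𝓥 α β ε σ ^ 2)
        (fun ε σ => max (ε ^ (2 * s / (s + t))) (σ ^ (2 * min (s / t) 1)))) := by
  simp only [← mul_neg, Real.exp_mul]
  refine ⟨fun hb ha => ?_, fun hb ha => ?_, fun hb ha => ?_, fun hb ha => ?_⟩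
  · exact gtrsimSmallNoise_minimaxRadius isScale_natCast
      isScale_natCast hs.le ha hb hα hβ hαβ hC₀ hC₁ hC hb𝓥
      (isSignPriorRate_of_rpow_of_rpow hs.le ht.le ha hb)
      (isOperatorRate_rpow_min isScale_natCast hs.le ht ha hb)
  · have ha₁ := (ha.pos fun j => Real.rpow_pos_of_pos (isScale_exp.pos j) s) 1
    have hb₁ := (hb.pos fun j => Real.rpow_pos_of_pos (isScale_natCast.pos j) (-t)) 1
    exact gtrsimSmallNoise_minimaxRadius isScale_exp
      isScale_natCast hs.le ha hb hα hβ hαβ hC₀ hC₁ hC hb𝓥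
      (isSignPriorRate_of_exp_of_rpow hs ht.le ha hb)
      (isOperatorRate_sq ha₁.ne' hb₁.ne')
  · exact gtrsimSmallNoise_minimaxRadius isScale_natCast
      isScale_exp hs.le ha hb hα hβ hαβ hC₀ hC₁ hC hb𝓥
      (isSignPriorRate_log hs.le ht ha hb) (isOperatorRate_log hs.le ht ha hb)
  · exact gtrsimSmallNoise_minimaxRadius isScale_exp
      isScale_exp hs.le ha hb hα hβ hαβ hC₀ hC₁ hC hb𝓥
      (isSignPriorRate_rpow isScale_exp hs.le ht ha hb)
      (isOperatorRate_rpow_min isScale_exp hs.le ht ha hb)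

theorem theorem5
    (α β : ℝ) (hα : α ∈ Set.Ioo (0 : ℝ) 1) (hβ : β ∈ Set.Ioo (0 : ℝ) (1 - α))
    (s t : ℝ) (hs : 0 < s) (ht : 0 < t)
    (a : ℕ+ → ℝ) (ha_pos : ∀ j, 0 < a j) (ha_mono : Monotone a) (ha_top : Tendsto a atTop atTop)
    (b : ℕ+ → ℝ) (hb_pos : ∀ j, 0 < b j)
    (C₀ C₁ : ℝ) (hC₀ : 0 < C₀) (hC₀' : C₀ ≤ 1) (hC₁ : 1 ≤ C₁) (hC : C₀ < C₁)
    (𝓥 : Set (ℕ+ → ℝ)) (hb𝓥 : b ∈ 𝓥) (h𝓥 : 𝓥 ⊆ NoisyGSM.singularClass b C₀ C₁) :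
    (NoisyGSM.Comparable b (fun j => ((j : ℕ) : ℝ) ^ (-t)) →
      NoisyGSM.Comparable a (fun j => ((j : ℕ) : ℝ) ^ s) →
      NoisyGSM.GtrsimSmallNoise
        (fun ε σ => NoisyGSM.minimaxRadius a (NoisyGSM.singularClass b C₀ C₁) 𝓥 α β ε σ ^ 2)
        (fun ε σ => max (ε ^ (4 * s / (2 * s + 2 * t + 1 / 2))) (σ ^ (2 * min (s / t) 1)))) ∧
    (NoisyGSM.Comparable b (fun j => ((j : ℕ) : ℝ) ^ (-t)) →
      NoisyGSM.Comparable a (fun j => Real.exp (((j : ℕ) : ℝ) * s)) →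
      NoisyGSM.GtrsimSmallNoise
        (fun ε σ => NoisyGSM.minimaxRadius a (NoisyGSM.singularClass b C₀ C₁) 𝓥 α β ε σ ^ 2)
        (fun ε σ => max (ε ^ 2 * Real.log (1 / ε) ^ (2 * t + 1 / 2)) (σ ^ 2))) ∧
    (NoisyGSM.Comparable b (fun j => Real.exp (-(((j : ℕ) : ℝ) * t))) →
      NoisyGSM.Comparable a (fun j => ((j : ℕ) : ℝ) ^ s) →
      NoisyGSM.GtrsimSmallNoise
        (fun ε σ => NoisyGSM.minimaxRadius a (NoisyGSM.singularClass b C₀ C₁) 𝓥 α β ε σ ^ 2)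
        (fun ε σ => max (Real.log (1 / ε) ^ (-2 * s)) (Real.log (1 / σ) ^ (-2 * s)))) ∧
    (NoisyGSM.Comparable b (fun j => Real.exp (-(((j : ℕ) : ℝ) * t))) →
      NoisyGSM.Comparable a (fun j => Real.exp (((j : ℕ) : ℝ) * s)) →
      NoisyGSM.GtrsimSmallNoise
        (fun ε σ => NoisyGSM.minimaxRadius a (NoisyGSM.singularClass b C₀ C₁) 𝓥 α β ε σ ^ 2)
        (fun ε σ => max (ε ^ (2 * s / (s + t))) (σ ^ (2 * min (s / t) 1)))) := by
  exact theorem5_general hα.1.le hβ.1.le (by linarith [hβ.2]) hs ht hC₀' hC₁ hC hb𝓥
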